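/- Setting. Let $\mathcal H$ be a finite class of functions $\mathcal X\to\mathcal Y$, where the label space $\mathcal Y$ is finite with $|\mathcal Y|=k$. Its Littlestone dimension $\mathrm{Ldim}(\mathcal H)$ is the largest $n$ such that $\mathcal H$ shatters a complete binary tree of depth $n$ whose internal nodes are labeled by points of $\mathcal X$ and in which the two edges leaving a node carry two distinct labels; shattering means that for every root-to-leaf path some $h\in\mathcal H$ takes the prescribed label at every node of the path. In learning from equivalence queries with bandit feedback there is an unknown target $c\in\mathcal H$. In each round the learner proposes some $h\in\mathcal H$ (possibly at random, depending on the earlier queries and answers). If $h=c$, the query is accepted and the interaction ends. If $h\ne c$, the environment either returns an unlabeled counterexample, i.e. a point $x$ with $h(x)\neq c(x)$ (the label $c(x)$ is not revealed), or accepts, which also ends the interaction. Its answer is drawn from a law $\mathrm{CE}(h,c\mid h_1,\dots,h_{t-1})$ that depends only on $h$, $c$ and the earlier queries. The adversary is symmetric if $\mathrm{CE}(h,c\mid h_1,\dots,h_{t-1})=\mathrm{CE}(c,h\mid h_1,\dots,h_{t-1})$ for all $h\neq c$ and all histories. The final, accepted query is counted. Theorem. (Upper bound.) There is a universal constant $C$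 such that for every finite class $\mathcal H$ with $\mathrm{Ldim}(\mathcal H)=d\ge 1$ over a label space of size $k$ and every symmetric adversary $\mathcal A$ there is a learning rule such that, for every target $c\in\mathcal H$, the expected number of queries until termination is at most $C\,d\,k\log k$. (Lower bound.) There is a universal constant $C'>0$ such that the following hold. (a) Let $p\ge 3$ be prime and $d\ge 2$. The class $\mathcal H$ of nonzero linear functionals $\mathbb F_p^d\to\mathbb F_p$ satisfies $\mathrm{Ldim}(\mathcal H)=d$, the adversary that returns a uniformly random point of $\{x: h(x)\ne c(x)\}$ whenever $h\neq c$ is symmetric, and for every learning rule there is a target $c\in\mathcal H$ for which the expected number of queries against this adversary is at least $C'\,d\,p\log p$. (b) For all $k\ge2$ and $d\ge 2$ there are a finite class $\mathcal H$ with $\mathrm{Ldim}(\mathcal H)=d$ over a label space of size $k$ and a symmetric adversary, which never accepts an incorrect hypothesis, such that for every learning rule there is a target $c\in\mathcal H$ for which the expected number of queries is at least $C'\,d\,k\log k$. -/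

import Mathlib

open MeasureTheory ProbabilityTheory
open scoped ENNReal

universe u v

namespace BanditEQ

/-! ### Littlestone dimension -/

/-- Complete binary mistake trees of a given depth. Every internal node carries an instance, and its
two outgoing edges carry two distinct labels. -/
inductive MistakeTree (X : Type u) (Y : Type v) : ℕ → Type (max u v)
  | leaf : MistakeTree X Y 0
  | node {n : ℕ} (x : X) (label : Bool → Y) (distinct : label false ≠ label true)
      (child : Bool → MistakeTree X Y n) : MistakeTree X Y (n + 1)

/-- The path induced by `h` in the tree is the root-to-leaf path given by the directions `b`. -/
def MistakeTree.Follows {X : Type u} {Y : Type v} (h : X → Y) :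
    {n : ℕ} → MistakeTree X Y n → (Fin n → Bool) → Prop
  | 0, .leaf, _ => True
  | _ + 1, .node x label _ child, b =>
      h x = label (b 0) ∧ MistakeTree.Follows h (child (b 0)) (fun i => b i.succ)

/-- `H` shatters the tree: every root-to-leaf path is induced by some hypothesis in `H`. -/
def MistakeTree.IsShattered {X : Type u} {Y : Type v} {n : ℕ} (T : MistakeTree X Y n)
    (H : Finset (X → Y)) : Prop :=
  ∀ b : Fin n → Bool, ∃ h ∈ H, T.Follows h b

/-- The Littlestone dimension of `H`: the supremum of the depths of the mistake trees that are
shattered by `H`. (It is only used for nonempty classes; for the empty class the value is `0`.) -/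
noncomputable def ldim {X : Type u} {Y : Type v} (H : Finset (X → Y)) : ℕ∞ :=
  ⨆ n ∈ {n : ℕ | ∃ T : MistakeTree X Y n, T.IsShattered H}, (n : ℕ∞)

/-! ### Hypotheses, counterexample generators, learners -/

/-- The members of the finite class `H`, as a finite discrete measurable space. -/
def Hyp {X : Type u} {Y : Type v} (H : Finset (X → Y)) : Type (max u v) := {h : X → Y // h ∈ H}

namespace Hyp

variable {X : Type u} {Y : Type v} {H : Finset (X → Y)}

instance : Finite (Hyp H) := inferInstanceAs (Finite {h : X → Y // h ∈ H})

instance : MeasurableSpace (Hyp H) := ⊤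

instance : DiscreteMeasurableSpace (Hyp H) := ⟨fun _ => trivial⟩

instance : CoeFun (Hyp H) (fun _ => X → Y) := ⟨Subtype.val⟩

end Hyp

/-- A (randomized, history-dependent) counterexample generator for the class `H`.
`reject past h c` is the law of the counterexample returned when the target is `c`, the current
query is `h ≠ c`, and the earlier queries were `past`, in this order. It is carried by the points
where `h` and `c` disagree. Its total mass is the probability that `h` is rejected; the missing
mass is the probability that the environment accepts `h` although `h ≠ c`.
The values at `h = c` are irrelevant: `c` itself is always accepted. -/
structure Generator {X : Type u} {Y : Type v} [MeasurableSpace X] (H : Finset (X → Y)) where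
  reject : {n : ℕ} → (past : Fin n → Hyp H) → (h c : Hyp H) → Measure X
  mass_le_one : ∀ {n : ℕ} (past : Fin n → Hyp H) (h c : Hyp H), h ≠ c →
    reject past h c Set.univ ≤ 1
  disagree : ∀ {n : ℕ} (past : Fin n → Hyp H) (h c : Hyp H), h ≠ c →
    ∀ᵐ x ∂(reject past h c), h x ≠ c x

/-- The generator treats the query and the target interchangeably. -/
def Generator.IsSymmetric {X : Type u} {Y : Type v} [MeasurableSpace X] {H : Finset (X → Y)}
    (A : Generator H) : Prop :=
  ∀ {n : ℕ} (past : Fin n → Hyp H) (h c : Hyp H), h ≠ c → A.reject past h c = A.reject past c h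

/-- The generator never accepts an incorrect hypothesis: it always returns a counterexample. -/
def Generator.IsExact {X : Type u} {Y : Type v} [MeasurableSpace X] {H : Finset (X → Y)}
    (A : Generator H) : Prop :=
  ∀ {n : ℕ} (past : Fin n → Hyp H) (h c : Hyp H), h ≠ c →
    IsProbabilityMeasure (A.reject past h c)

/-- A (randomized, proper) learning rule with bandit feedback: the law of the next query, as a
function of the earlier queries and of the unlabeled counterexamples returned for them. -/
structure Learner {X : Type u} {Y : Type v} [MeasurableSpace X] (H : Finset (X → Y)) where
  query : (n : ℕ) → Kernel (Fin n → Hyp H × X) (Hyp H)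
  isMarkov : ∀ n, IsMarkovKernel (query n)

/-! ### The interaction -/

section Interaction

variable {X : Type u} {Y : Type v} [MeasurableSpace X] {H : Finset (X → Y)}

open Classical in
/-- The response of the environment with target `c` after `n` rejected queries, as a sub-Markov
kernel: given the transcript so far and the current query `h`, the law of the counterexample on the
event that `h` is rejected. The target itself is never rejected. -/
noncomputable def Generator.response (A : Generator H) (c : Hyp H) (n : ℕ) :
    Kernel ((Fin n → Hyp H × X) × Hyp H) X where
  toFun p := if p.2 = c then 0 else A.reject (fun i => (p.1 i).1) p.2 c
  measurable' := by
    have h1 : Measurable (fun q : (Fin n → Hyp H) × Hyp H =>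
        if q.2 = c then (0 : Measure X) else A.reject q.1 q.2 c) := Measurable.of_discrete
    have h2 : Measurable (fun p : (Fin n → Hyp H × X) × Hyp H =>
        ((fun i => (p.1 i).1 : Fin n → Hyp H), p.2)) := by fun_prop
    exact h1.comp h2

/-- `rejectedLaw A L c n` is the law of the transcript of the first `n` rounds (queries and
counterexamples) of the interaction between the learner `L` and the generator `A` with target `c`,
restricted to the event that the first `n` queries are all rejected. -/
noncomputable def rejectedLaw (A : Generator H) (L : Learner H) (c : Hyp H) :
    (n : ℕ) → Measure (Fin n → Hyp H × X)
  | 0 => Measure.dirac (fun i => i.elim0)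
  | n + 1 => ((rejectedLaw A L c n) ⊗ₘ (L.query n ⊗ₖ A.response c n)).map
      (fun p => (Fin.snoc p.1 p.2 : Fin (n + 1) → Hyp H × X))

/-- The expectation of the number `T` of queries made until a query is accepted (the accepted query
is counted): `E[T] = ∑ₙ P(T > n)`, and `T > n` means that the first `n` queries are rejected. -/
noncomputable def expectedQueries (A : Generator H) (L : Learner H) (c : Hyp H) : ℝ≥0∞ :=
  ∑' n : ℕ, rejectedLaw A L c n Set.univ

end Interaction

/-! ### Linear functionals and uniformly random counterexamples -/

/-- The generator that returns a uniformly random point of disagreement. -/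
noncomputable def uniformGenerator {X : Type u} {Y : Type v} [MeasurableSpace X]
    [DiscreteMeasurableSpace X] [Finite X] (H : Finset (X → Y)) : Generator H where
  reject _ h c := uniformOn {x : X | h x ≠ c x}
  mass_le_one _ _ _ _ := prob_le_one
  disagree _ h c _ := by
    rw [ae_iff, uniformOn_eq_zero_iff (Set.toFinite _)]
    ext x
    simp

/-- The class of all nonzero linear functionals `𝔽_p ^ d → 𝔽_p`. -/
noncomputable def linearFunctionals (p d : ℕ) [NeZero p] :
    Finset ((Fin d → ZMod p) → ZMod p) :=
  (Set.toFinite {f : (Fin d → ZMod p) → ZMod p |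
    ∃ φ : (Fin d → ZMod p) →ₗ[ZMod p] ZMod p, φ ≠ 0 ∧ f = ⇑φ}).toFinset

end BanditEQ

open BanditEQ

namespace BanditEQ


/-! ### A minimax principle -/

/-! Upper bound. The experts are the possible label sequences of the counterexamples seen so far.
Each one predicts the next label by the standard optimal algorithm on the version space it
determines, and exactly one of them, `labels τ c`, is right about the target `c`. The learner keeps
weights of total mass at most one on the experts. The potential of `c` is `1 - log w + 10 log k *
ldim`, with `w` the weight of its expert and `ldim` the dimension of its version space. When that
expert errs, the dimension drops (`ldimNat_restrict_lt`), which pays for the loss of weight. The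
core is one round (`exists_uniform_progress`): some query law and reweighting make progress of order
`1/k` against all targets at once. By minimax (`exists_forall_lt_of_forall_prior` with
`convex_progress`) it suffices to treat a known prior on the targets. There Thompson sampling works
(`exists_bayes_action`): by symmetry of the adversary, query and target have the same law given the
counterexample `z`, so the label of the query at `z`, which is known to be wrong, carries on average
at least `1/k` of the posterior mass of labels. Experts predicting it are demoted and the others
gain. The potential starts at `1 + 10 d log k` and drops by `1/(8k)` per round in expectation,
whence `O(d k log k)` queries (`mul_expectedQueries_le_of_drift`). Lower bound. Two distinct linear
functionals disagree on a fraction `1 - 1/p` of the space, so a random counterexample has density at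
most `β = 1 + 1/(p-1)` with respect to a uniform point. Replacing counterexamples by uniform points,
which ignore the target, costs a factor `β` per round. Hence the probabilities of stopping in round
`n + 1`, summed over all targets, are at most `β ^ n` (`card_le_sum_rejectedLaw_add`). With about `p
^ d` targets, this needs `n` of order `d p log p` before half of the mass is gone. For general `k`,
Bertrand's postulate supplies a prime comparable to `k`. -/

theorem exists_forall_lt_of_forall_prior {I : Type*} [Fintype I] [Nonempty I] {S : Set (I → ℝ)}
    (hS : Convex ℝ S) {b b' : ℝ} (hb : b < b')
    (h : ∀ μ : I → ℝ, (∀ i, 0 ≤ μ i) → ∑ i, μ i = 1 → ∃ v ∈ S, b' ≤ ∑ i, μ i * v i) :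
    ∃ v ∈ S, ∀ i, b < v i := by
  classical
  by_contra hcon
  -- Separate the open orthant above `b` from `S`. The separating functional, normalised, is a prior
  -- that violates `h`. The gap `b < b'` makes any closedness of `S` unnecessary.
  have hO : IsOpen (Set.pi Set.univ (fun _ : I => Set.Ioi b)) :=
    isOpen_set_pi Set.finite_univ fun _ _ => isOpen_Ioi
  have hOc : Convex ℝ (Set.pi Set.univ (fun _ : I => Set.Ioi b)) :=
    convex_pi fun _ _ => convex_Ioi b
  have hdisj : Disjoint (Set.pi Set.univ (fun _ : I => Set.Ioi b)) S := by
    rw [Set.disjoint_left]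
    intro v hv hvS
    exact hcon ⟨v, hvS, fun i => hv i trivial⟩
  obtain ⟨f, u, hf, hu⟩ := geometric_hahn_banach_open hOc hO hS hdisj
  set e : I → ℝ := fun i => f (Pi.single i 1) with he
  have hfe : ∀ v : I → ℝ, f v = ∑ i, v i * e i := by
    intro v
    have := LinearMap.pi_apply_eq_sum_univ (f : (I → ℝ) →ₗ[ℝ] ℝ) v
    simp only [ContinuousLinearMap.coe_coe, smul_eq_mul] at this
    rw [this]
    refine Finset.sum_congr rfl fun i _ => ?_
    rw [he]
    congr 2
    ext j
    simp [Pi.single_apply, eq_comm]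
  have hconst : ∀ x, b < x → x * ∑ i, e i < u := by
    intro x hx
    have := hf (fun _ => x) (fun i _ => hx)
    rwa [hfe, ← Finset.mul_sum] at this
  have hneg : ∀ i, e i ≤ 0 := by
    intro i
    by_contra hi
    push Not at hi
    obtain ⟨n, hn⟩ := exists_nat_gt ((u - (b + 1) * ∑ i, e i) / e i)
    have := hf (fun j => b + 1 + if j = i then (n : ℝ) else 0) (by
      intro j _
      simp only [Set.mem_Ioi]
      split_ifs
      · have : (0 : ℝ) ≤ n := Nat.cast_nonneg n
        linarith
      · linarith)
    rw [hfe] at this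
    simp only [add_mul, ite_mul, zero_mul, Finset.sum_add_distrib, Finset.sum_ite_eq',
      Finset.mem_univ, if_true] at this
    rw [div_lt_iff₀ hi] at hn
    simp only [← Finset.mul_sum] at this
    nlinarith
  have hsum : ∑ i, e i < 0 := by
    -- If the sum vanished, the functional would be zero, giving `0 < u` on the orthant and `u ≤ 0`
    -- on `S`, which is nonempty by `h`.
    refine lt_of_le_of_ne (Finset.sum_nonpos fun i _ => hneg i) fun h0 => ?_
    have h1 := hconst (b + 1) (by linarith)
    obtain ⟨v, hv, _⟩ := h (fun _ => 1 / Fintype.card I) (fun _ => by positivity) (by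
      simp)
    have h2 := hu v hv
    have h3 : ∀ i, e i = 0 := by
      intro i
      exact (Finset.sum_eq_zero_iff_of_nonpos fun i _ => hneg i).1 h0 i (Finset.mem_univ i)
    rw [hfe] at h2
    simp [h3] at h1 h2
    linarith
  set s := ∑ i, e i with hs
  obtain ⟨v, hv, hv'⟩ := h (fun i => e i / s) (fun i => div_nonneg_of_nonpos (hneg i) hsum.le)
    (by rw [← Finset.sum_div]; exact div_self hsum.ne)
  have h2 := hu v hv
  have h3 : ∑ i, e i / s * v i = f v / s := by
    rw [hfe, Finset.sum_div]
    exact Finset.sum_congr rfl fun i _ => by ring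
  rw [h3, le_div_iff_of_neg hsum] at hv'
  have := hconst ((b + b') / 2) (by linarith)
  nlinarith

/-! ### One round of the weighted learner -/

/-- The indicator of `y ≠ y'`. -/
noncomputable def mismatch {Y : Type*} (y y' : Y) : ℝ :=
  open Classical in if y = y' then 0 else 1

theorem mismatch_nonneg {Y : Type*} (y y' : Y) : 0 ≤ mismatch y y' := by
  unfold mismatch; split_ifs <;> norm_num

/-- The expected progress against the target `c` of the learner that draws a query from `π` and
replaces the weight vector `w` on the experts `S` by `g h z` when the counterexample to `h` is `z`.
The expert that is right about `c` is `E c`, and expert `s` predicts the label `f s z` at `z`. -/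
noncomputable def progress {I S Z Y : Type*} [Fintype I] [Fintype Z] (CE : I → I → Z → ℝ)
    (ev : I → Z → Y) (E : I → S) (w : S → ℝ) (f : S → Z → Y) (π : I → ℝ) (g : I → Z → S → ℝ)
    (c : I) : ℝ :=
  ∑ h, π h * (1 - ∑ z, CE h c z + ∑ z, CE h c z *
    (Real.log (g h z (E c)) - Real.log (w (E c)) + 2 * mismatch (ev c z) (f (E c) z)))

/-- Drop the term `η * w` and apply `log x ≥ 1 - 1/x` to each of the factors `1 - η`, `m / (M w)`
and `M (2 - i) / (2M - Q)`. For a demoted expert (`i = 1`) the last factor may cost up to `1`. This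
is charged to one of the two copies of `D`, because such an expert has made a mistake. -/
theorem log_mixture_lower_bound {m M w Q D i η : ℝ} (hm : 0 < m) (hM : m ≤ M) (hw : 0 < w)
    (hQ0 : 0 ≤ Q) (hQ : Q ≤ M) (hi : i = 0 ∨ i = 1 ∧ D = 1) (hD : 0 ≤ D) (hη0 : 0 < η)
    (hη : η ≤ 1 / 2) :
    -(2 * η) + (1 - M * w / m) + Q / (2 * M) + D ≤
      Real.log ((1 - η) * (m * (2 - i) / (2 * M - Q)) + η * w) - Real.log w + 2 * D := by
  have hMp : 0 < M := hm.trans_le hM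
  have hden : 0 < 2 * M - Q := by linarith
  have hi2 : 0 < 2 - i := by rcases hi with h | ⟨h, _⟩ <;> rw [h] <;> norm_num
  have h1η : 0 < 1 - η := by linarith
  have h1 : Real.log ((1 - η) * (m * (2 - i) / (2 * M - Q))) ≤
      Real.log ((1 - η) * (m * (2 - i) / (2 * M - Q)) + η * w) := by
    apply Real.log_le_log (by positivity)
    nlinarith [mul_pos hη0 hw]
  have h2 : Real.log ((1 - η) * (m * (2 - i) / (2 * M - Q))) =
      Real.log (1 - η) + (Real.log (m / (M * w)) + Real.log (M * (2 - i) / (2 * M - Q)))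
        + Real.log w := by
    rw [← Real.log_mul (by positivity) (by positivity), ← Real.log_mul (by positivity)
      (by positivity), ← Real.log_mul (by positivity) (by positivity)]
    congr 1
    field_simp
  have h3 : -(2 * η) ≤ Real.log (1 - η) := by
    refine le_trans ?_ (Real.one_sub_inv_le_log_of_pos h1η)
    rw [← sub_nonneg]
    have : 1 - (1 - η)⁻¹ - -(2 * η) = η * (1 - 2 * η) / (1 - η) := by
      field_simp
      ring
    rw [this]
    exact div_nonneg (mul_nonneg hη0.le (by linarith)) h1η.le
  have h4 : 1 - M * w / m ≤ Real.log (m / (M * w)) := by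
    refine le_trans (le_of_eq ?_) (Real.one_sub_inv_le_log_of_pos (by positivity))
    rw [inv_div]
  have h5 : Q / (2 * M) - D ≤ Real.log (M * (2 - i) / (2 * M - Q)) := by
    refine le_trans ?_ (Real.one_sub_inv_le_log_of_pos (by positivity))
    rw [inv_div]
    rcases hi with h | ⟨h, h'⟩
    · rw [h, sub_zero]
      have : 1 - (2 * M - Q) / (M * 2) = Q / (2 * M) := by
        field_simp
        ring
      linarith
    · rw [h, h']
      have : 1 - (2 * M - Q) / (M * (2 - 1)) = Q / (2 * M) - 1 + Q / (2 * M) := by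
        field_simp
        ring
      have : 0 ≤ Q / (2 * M) := by positivity
      linarith
  linarith

/-- Cauchy–Schwarz over the labels: two independent draws from a law on `I` have the same label with
probability at least `1 / |Y|`. This is how the number of labels enters the upper bound. -/
theorem sq_sum_le_card_mul_sum_fiber {I Y : Type*} [Fintype I] [Fintype Y] [DecidableEq Y]
    (t : I → ℝ) (e : I → Y) :
    (∑ c, t c) ^ 2 ≤ Fintype.card Y * ∑ h, ∑ c, if e c = e h then t h * t c else 0 := by
  have h1 : ∑ c, t c = ∑ y, ∑ c, if e c = y then t c else 0 := by
    rw [Finset.sum_comm]; simp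
  have h2 : ∑ h, ∑ c, (if e c = e h then t h * t c else 0) =
      ∑ y, (∑ c, if e c = y then t c else 0) ^ 2 := by
    have : ∀ y, (∑ c, if e c = y then t c else 0) ^ 2 =
        ∑ h, if e h = y then ∑ c, (if e c = y then t h * t c else 0) else 0 := by
      intro y
      rw [sq, Finset.sum_mul]
      refine Finset.sum_congr rfl fun h _ => ?_
      split_ifs with hh
      · rw [Finset.mul_sum]
        exact Finset.sum_congr rfl fun c _ => by split_ifs <;> simp
      · simp
    rw [Finset.sum_congr rfl fun y _ => this y]
    conv_rhs => rw [Finset.sum_comm]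
    simp
  rw [h1, h2]
  exact sq_sum_le_card_mul_sum_sq

section Round

variable {I S Z Y : Type*} [Fintype I] [Fintype S] [Fintype Z]

/-- Thompson sampling: against a prior `μ` on the target, the learner draws the query from `μ` and
reweights the experts by their posterior probabilities. -/
theorem exists_bayes_action [Fintype Y] (CE : I → I → Z → ℝ) (hCE : ∀ h c z, 0 ≤ CE h c z)
    (hsum : ∀ h c, ∑ z, CE h c z ≤ 1) (hsym : ∀ h c z, CE h c z = CE c h z)
    (ev : I → Z → Y) (hdis : ∀ h c z, CE h c z ≠ 0 → ev h z ≠ ev c z)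
    (E : I → S) (w : S → ℝ) (hw : ∀ s, 0 < w s) (hw1 : ∑ s, w s ≤ 1) (f : S → Z → Y)
    (hk : 0 < Fintype.card Y) (μ : I → ℝ) (hμ : ∀ i, 0 ≤ μ i) (hμ1 : ∑ i, μ i = 1) :
    ∃ g : I → Z → S → ℝ, (∀ h z s, 0 < g h z s) ∧ (∀ h z, ∑ s, g h z s ≤ 1) ∧
      3 / (8 * Fintype.card Y : ℝ) ≤ ∑ c, μ c * progress CE ev E w f μ g c := by
  classical
  set k : ℝ := (Fintype.card Y : ℝ) with hkdef
  have hk1 : (1 : ℝ) ≤ k := Nat.one_le_cast.2 hk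
  have hkp : 0 < k := by linarith
  set η : ℝ := 1 / (16 * k) with hη
  have hη0 : 0 < η := by positivity
  have hη2 : η ≤ 1 / 2 := by
    rw [hη]; apply one_div_le_one_div_of_le <;> linarith
  -- `t c z` is the joint probability of target `c` and counterexample `z`. Its marginals are `m` on
  -- the expert of the target and `M` on `z`, and `Q z a` is the part of `M z` whose expert predicts
  -- `a`.
  set t : I → Z → ℝ := fun c z => μ c * ∑ h, μ h * CE h c z with ht
  have ht0 : ∀ c z, 0 ≤ t c z := fun c z =>
    mul_nonneg (hμ c) (Finset.sum_nonneg fun h _ => mul_nonneg (hμ h) (hCE h c z))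
  set m : S → Z → ℝ := fun s z => ∑ c, if E c = s then t c z else 0 with hm
  set M : Z → ℝ := fun z => ∑ c, t c z with hM
  set Q : Z → Y → ℝ := fun z a => ∑ c, if f (E c) z = a then t c z else 0 with hQ
  have hM0 : ∀ z, 0 ≤ M z := fun z => Finset.sum_nonneg fun c _ => ht0 c z
  have hm0 : ∀ s z, 0 ≤ m s z := fun s z => Finset.sum_nonneg fun c _ => by
    split_ifs <;> simp [ht0]
  have hQ0 : ∀ z a, 0 ≤ Q z a := fun z a => Finset.sum_nonneg fun c _ => by
    split_ifs <;> simp [ht0]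
  have hQM : ∀ z a, Q z a ≤ M z := fun z a => Finset.sum_le_sum fun c _ => by
    split_ifs <;> simp [ht0]
  have hfib : ∀ (z : Z) (G : S → ℝ), ∑ s, m s z * G s = ∑ c, t c z * G (E c) := by
    intro z G
    simp only [hm, Finset.sum_mul]
    rw [Finset.sum_comm]
    simp
  have hmM : ∀ s z, m s z ≤ M z := fun s z => Finset.sum_le_sum fun c _ => by
    split_ifs <;> simp [ht0]
  have htm : ∀ c z, t c z ≤ m (E c) z := fun c z => by
    have := Finset.single_le_sum (f := fun c' => if E c' = E c then t c' z else 0)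
      (fun c' _ => by split_ifs <;> simp [ht0]) (Finset.mem_univ c)
    simpa using this
  set i : Z → Y → S → ℝ := fun z a s => if f s z = a then 1 else 0 with hi
  have hi01 : ∀ z a s, i z a s = 0 ∨ i z a s = 1 := fun z a s => by
    simp only [hi]; split_ifs <;> simp
  -- The posterior of the experts given `z`, with those predicting the refuted label `ev h z`
  -- halved. The normaliser is `2M - Q`, and the admixture of `η * w` keeps all weights positive.
  refine ⟨fun h z s => (1 - η) * (m s z * (2 - i z (ev h z) s) / (2 * M z - Q z (ev h z))) +
    η * w s, ?_, ?_, ?_⟩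
  · intro h z s
    have h1 : 0 ≤ m s z * (2 - i z (ev h z) s) / (2 * M z - Q z (ev h z)) := by
      apply div_nonneg
      · apply mul_nonneg (hm0 s z)
        rcases hi01 z (ev h z) s with h | h <;> rw [h] <;> norm_num
      · linarith [hQM z (ev h z), hM0 z]
    have h2 : 0 < η * w s := mul_pos hη0 (hw s)
    have h3 : 0 ≤ (1 - η) := by linarith
    nlinarith [mul_nonneg h3 h1]
  · intro h z
    rw [Finset.sum_add_distrib, ← Finset.mul_sum, ← Finset.mul_sum, ← Finset.sum_div]
    have h1 : ∑ s, m s z * (2 - i z (ev h z) s) = 2 * M z - Q z (ev h z) := by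
      rw [hfib z (fun s => 2 - i z (ev h z) s)]
      simp only [hi, hM, hQ, mul_sub, Finset.sum_sub_distrib, Finset.mul_sum, mul_ite, mul_one,
        mul_zero]
      congr 1
      exact Finset.sum_congr rfl fun c _ => mul_comm _ _
    rw [h1]
    have h2 := div_self_le_one (2 * M z - Q z (ev h z))
    nlinarith
  · set D : I → Z → ℝ := fun c z => mismatch (ev c z) (f (E c) z) with hD
    have hD0 : ∀ c z, 0 ≤ D c z := fun c z => mismatch_nonneg _ _
    have hMtot : ∑ z, M z = ∑ c, ∑ h, μ c * μ h * ∑ z, CE h c z := by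
      simp only [hM, ht, Finset.mul_sum]
      rw [Finset.sum_comm]
      refine Finset.sum_congr rfl fun c _ => ?_
      rw [Finset.sum_comm]
      refine Finset.sum_congr rfl fun h _ => Finset.sum_congr rfl fun z _ => by ring
    have hμμ : ∑ c, ∑ h, μ c * μ h = 1 := by
      simp only [← Finset.mul_sum, hμ1, mul_one]
    have hMle : ∑ z, M z ≤ 1 := by
      rw [hMtot, ← hμμ]
      refine Finset.sum_le_sum fun c _ => Finset.sum_le_sum fun h _ => ?_
      exact mul_le_of_le_one_right (mul_nonneg (hμ c) (hμ h)) (hsum h c)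
    have hpt : ∀ c h z, μ c * μ h * CE h c z * (-(2 * η) + (1 - M z * w (E c) / m (E c) z) +
        Q z (ev h z) / (2 * M z) + D c z) ≤ μ c * μ h * CE h c z *
        (Real.log ((1 - η) * (m (E c) z * (2 - i z (ev h z) (E c)) /
          (2 * M z - Q z (ev h z))) + η * w (E c)) - Real.log (w (E c)) + 2 * D c z) := by
      intro c h z
      have hnn : 0 ≤ μ c * μ h * CE h c z := mul_nonneg (mul_nonneg (hμ c) (hμ h)) (hCE h c z)
      rcases hnn.eq_or_lt with h0 | hpos
      · rw [← h0]; simp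
      refine mul_le_mul_of_nonneg_left ?_ hnn
      have hne : CE h c z ≠ 0 := fun h0 => by rw [h0] at hpos; simp at hpos
      have htpos : 0 < t c z := by
        refine hpos.trans_le ?_
        have := Finset.single_le_sum (f := fun h => μ h * CE h c z)
          (fun h _ => mul_nonneg (hμ h) (hCE h c z)) (Finset.mem_univ h)
        have := mul_le_mul_of_nonneg_left this (hμ c)
        simp only [ht]
        linarith
      refine log_mixture_lower_bound (htpos.trans_le (htm c z)) (hmM _ z) (hw _) (hQ0 z _)
        (hQM z _) ?_ (hD0 c z) hη0 hη2
      by_cases hfa : f (E c) z = ev h z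
      · right
        refine ⟨by simp [hi, hfa], ?_⟩
        simp only [hD, mismatch, hfa]
        rw [if_neg (hdis h c z hne).symm]
      · left
        simp [hi, hfa]
    -- Gibbs' inequality: passing from `w` to the posterior of the experts does not lose on average.
    have hgibbs : ∀ z, 0 ≤ ∑ c, t c z * (1 - M z * w (E c) / m (E c) z) := by
      intro z
      rw [← hfib z (fun s => 1 - M z * w s / m s z)]
      have h1 : ∀ s, m s z - M z * w s ≤ m s z * (1 - M z * w s / m s z) := by
        intro s
        rcases (hm0 s z).eq_or_lt with h0 | hpos
        · rw [← h0]
          have := mul_nonneg (hM0 z) (hw s).le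
          simpa using this
        · rw [mul_sub, mul_one, mul_div_cancel₀ _ hpos.ne']
      refine le_trans ?_ (Finset.sum_le_sum fun s _ => h1 s)
      rw [Finset.sum_sub_distrib, ← Finset.mul_sum]
      have h2 : ∑ s, m s z = M z := by
        have := hfib z (fun _ => 1)
        simpa using this
      rw [h2]
      nlinarith [hM0 z]
    -- If the expert of `c` is right, its prediction is `ev c z`, and the collision bound applies to
    -- the labels of query and target. If it errs, `D` covers the deficit.
    have hcs : ∀ z, M z / (2 * k) ≤ ∑ h, t h z * (Q z (ev h z) / (2 * M z)) + ∑ c, t c z * D c z := by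
      intro z
      rcases (hM0 z).eq_or_lt with h0 | hpos
      · rw [← h0]
        simp only [mul_zero, div_zero, zero_div, Finset.sum_const_zero, zero_add]
        exact Finset.sum_nonneg fun c _ => mul_nonneg (ht0 c z) (hD0 c z)
      have h1 : ∑ h, ∑ c, (if ev c z = ev h z then t h z * t c z else 0) ≤
          ∑ h, t h z * Q z (ev h z) + M z * ∑ c, t c z * D c z := by
        simp only [hM, hQ, Finset.mul_sum, Finset.sum_mul]
        rw [Finset.sum_comm (f := fun i j => t j z * (t i z * D i z)), ← Finset.sum_add_distrib]
        refine Finset.sum_le_sum fun h _ => ?_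
        rw [← Finset.sum_add_distrib]
        refine Finset.sum_le_sum fun c _ => ?_
        have hh := mul_nonneg (ht0 h z) (ht0 c z)
        by_cases hfe : ev c z = f (E c) z
        · have := mul_nonneg (ht0 h z) (mul_nonneg (ht0 c z) (hD0 c z))
          rw [← hfe, mul_ite, mul_zero]
          linarith
        · have hD1 : D c z = 1 := by simp [hD, mismatch, hfe]
          rw [hD1, mul_one]
          have : 0 ≤ t h z * if f (E c) z = ev h z then t c z else 0 := by
            refine mul_nonneg (ht0 h z) ?_
            split_ifs <;> simp [ht0]
          have : (if ev c z = ev h z then t h z * t c z else 0) ≤ t h z * t c z := by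
            split_ifs <;> linarith
          linarith
      have h2 := sq_sum_le_card_mul_sum_fiber (fun c => t c z) (fun c => ev c z)
      have h3 : M z ^ 2 / k ≤ ∑ h, t h z * Q z (ev h z) + M z * ∑ c, t c z * D c z := by
        rw [div_le_iff₀' hkp]
        exact h2.trans (mul_le_mul_of_nonneg_left h1 hkp.le)
      have h4 : ∑ h, t h z * (Q z (ev h z) / (2 * M z)) =
          (∑ h, t h z * Q z (ev h z)) / (2 * M z) := by
        rw [Finset.sum_div]
        exact Finset.sum_congr rfl fun h _ => by ring
      have h5 : M z / (2 * k) = M z ^ 2 / k / (2 * M z) := by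
        field_simp
      have h6 : M z ^ 2 / k / (2 * M z) ≤
          (∑ h, t h z * Q z (ev h z) + M z * ∑ c, t c z * D c z) / (2 * M z) :=
        div_le_div_of_nonneg_right h3 (by positivity)
      have h7 : M z * (∑ c, t c z * D c z) / (2 * M z) = (∑ c, t c z * D c z) / 2 := by
        field_simp
      have h8 : 0 ≤ ∑ c, t c z * D c z :=
        Finset.sum_nonneg fun c _ => mul_nonneg (ht0 c z) (hD0 c z)
      rw [add_div, h7] at h6
      rw [h4, h5]
      linarith
    have hsplit : ∀ z, ∑ c, ∑ h, μ c * μ h * CE h c z * (-(2 * η) +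
        (1 - M z * w (E c) / m (E c) z) + Q z (ev h z) / (2 * M z) + D c z) =
        -(2 * η) * M z + ∑ c, t c z * (1 - M z * w (E c) / m (E c) z) +
          (∑ h, t h z * (Q z (ev h z) / (2 * M z)) + ∑ c, t c z * D c z) := by
      intro z
      have e1 : ∀ G : I → ℝ, ∑ c, ∑ h, μ c * μ h * CE h c z * G c = ∑ c, t c z * G c := by
        intro G
        refine Finset.sum_congr rfl fun c _ => ?_
        simp only [ht, Finset.mul_sum, Finset.sum_mul]
        exact Finset.sum_congr rfl fun h _ => by ring
      -- Symmetry of the adversary enters here: the pair (query, counterexample) has the same joint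
      -- law `t` as (target, counterexample).
      have e2 : ∀ G : I → ℝ, ∑ c, ∑ h, μ c * μ h * CE h c z * G h = ∑ c, t c z * G c := by
        intro G
        rw [Finset.sum_comm]
        refine Finset.sum_congr rfl fun h _ => ?_
        simp only [ht, Finset.mul_sum, Finset.sum_mul]
        exact Finset.sum_congr rfl fun c _ => by rw [hsym h c]; ring
      simp only [mul_add, Finset.sum_add_distrib]
      rw [e1 (fun _ => -(2 * η)), e1 (fun c => 1 - M z * w (E c) / m (E c) z),
        e2 (fun h => Q z (ev h z) / (2 * M z)), e1 (fun c => D c z), ← Finset.sum_mul]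
      ring
    have hfinal : ∑ c, μ c * progress CE ev E w f μ (fun h z s =>
        (1 - η) * (m s z * (2 - i z (ev h z) s) / (2 * M z - Q z (ev h z))) + η * w s) c =
        1 - ∑ z, M z + ∑ z, ∑ c, ∑ h, μ c * μ h * CE h c z *
        (Real.log ((1 - η) * (m (E c) z * (2 - i z (ev h z) (E c)) /
          (2 * M z - Q z (ev h z))) + η * w (E c)) - Real.log (w (E c)) + 2 * D c z) := by
      rw [hMtot]
      conv_rhs => enter [1, 1]; rw [← hμμ]
      rw [Finset.sum_comm (s := (Finset.univ : Finset Z)),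
        ← Finset.sum_sub_distrib, ← Finset.sum_add_distrib]
      refine Finset.sum_congr rfl fun c _ => ?_
      rw [Finset.sum_comm (s := (Finset.univ : Finset Z)), ← Finset.sum_sub_distrib,
        ← Finset.sum_add_distrib, progress, Finset.mul_sum]
      refine Finset.sum_congr rfl fun h _ => ?_
      rw [← mul_assoc, mul_add, mul_sub, mul_one]
      congr 1
      rw [Finset.mul_sum]
      exact Finset.sum_congr rfl fun z _ => by ring
    rw [hfinal]
    have hz : ∑ z, (-(2 * η) * M z + M z / (2 * k)) ≤ ∑ z, ∑ c, ∑ h, μ c * μ h * CE h c z *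
        (Real.log ((1 - η) * (m (E c) z * (2 - i z (ev h z) (E c)) /
          (2 * M z - Q z (ev h z))) + η * w (E c)) - Real.log (w (E c)) + 2 * D c z) := by
      refine Finset.sum_le_sum fun z _ => ?_
      refine le_trans ?_ (Finset.sum_le_sum fun c _ => Finset.sum_le_sum fun h _ => hpt c h z)
      rw [hsplit]
      linarith [hgibbs z, hcs z]
    -- `1/(2k) - 2η = 3/(8k)` for `η = 1/(16k)`. The acceptance mass `1 - ∑ M` counts with
    -- coefficient `1 ≥ 3/(8k)`.
    have hz' : ∑ z, (-(2 * η) * M z + M z / (2 * k)) = 3 / (8 * k) * ∑ z, M z := by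
      rw [Finset.mul_sum]
      refine Finset.sum_congr rfl fun z _ => ?_
      rw [hη]
      field_simp
      ring
    have h38 : 3 / (8 * k) ≤ 1 := by
      rw [div_le_one (by positivity)]
      linarith
    nlinarith

/-- Jensen's inequality for `log` with weights proportional to `a p` and `b q`. -/
theorem mul_log_add_le {a b p q x y : ℝ} (ha : 0 ≤ a) (hb : 0 ≤ b) (hp : 0 ≤ p) (hq : 0 ≤ q)
    (hx : 0 < x) (hy : 0 < y) (hpos : 0 < a * p + b * q) :
    a * (p * Real.log x) + b * (q * Real.log y) ≤
      (a * p + b * q) * Real.log ((a * p * x + b * q * y) / (a * p + b * q)) := by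
  have h := strictConcaveOn_log_Ioi.concaveOn.2 (Set.mem_Ioi.2 hx) (Set.mem_Ioi.2 hy)
    (show 0 ≤ a * p / (a * p + b * q) by positivity)
    (show 0 ≤ b * q / (a * p + b * q) by positivity)
    (by rw [← add_div]; exact div_self hpos.ne')
  simp only [smul_eq_mul] at h
  have h2 := mul_le_mul_of_nonneg_left h hpos.le
  have e1 : (a * p + b * q) * (a * p / (a * p + b * q) * Real.log x +
      b * q / (a * p + b * q) * Real.log y) = a * (p * Real.log x) + b * (q * Real.log y) := by
    field_simp
  have e2 : a * p / (a * p + b * q) * x + b * q / (a * p + b * q) * y =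
      (a * p * x + b * q * y) / (a * p + b * q) := by
    field_simp
  rwa [e1, e2] at h2

/-- The progress vectors that the learner can guarantee in one round form a convex set. -/
theorem convex_progress (CE : I → I → Z → ℝ) (hCE : ∀ h c z, 0 ≤ CE h c z)
    (ev : I → Z → Y) (E : I → S) (w : S → ℝ) (f : S → Z → Y) :
    Convex ℝ {v : I → ℝ | ∃ (π : I → ℝ) (g : I → Z → S → ℝ), (∀ h, 0 ≤ π h) ∧ ∑ h, π h = 1 ∧
      (∀ h z s, 0 < g h z s) ∧ (∀ h z, ∑ s, g h z s ≤ 1) ∧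
      ∀ c, v c ≤ progress CE ev E w f π g c} := by
  classical
  rintro v₁ ⟨π₁, g₁, hπ₁, hπ₁', hg₁, hg₁', hv₁⟩ v₂ ⟨π₂, g₂, hπ₂, hπ₂', hg₂, hg₂', hv₂⟩ a b ha hb hab
  set π : I → ℝ := fun h => a * π₁ h + b * π₂ h with hπ
  have hπ0 : ∀ h, 0 ≤ π h := fun h =>
    add_nonneg (mul_nonneg ha (hπ₁ h)) (mul_nonneg hb (hπ₂ h))
  -- Toss an `a : b` coin between the two strategies, forget the outcome, and average `g₁`, `g₂` by
  -- their posterior probabilities given the query `h`. Concavity of `log` makes the average no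
  -- worse. Where `π h = 0` the value is arbitrary but must stay admissible.
  refine ⟨π, fun h z s => if 0 < π h then (a * π₁ h * g₁ h z s + b * π₂ h * g₂ h z s) / π h
    else g₁ h z s, hπ0, ?_, ?_, ?_, ?_⟩
  · simp only [hπ, Finset.sum_add_distrib, ← Finset.mul_sum, hπ₁', hπ₂']
    linarith
  · intro h z s
    dsimp only
    split_ifs with hp
    · refine div_pos ?_ hp
      have h1 := mul_nonneg (mul_nonneg ha (hπ₁ h)) (hg₁ h z s).le
      have h2 := mul_nonneg (mul_nonneg hb (hπ₂ h)) (hg₂ h z s).le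
      refine lt_of_le_of_ne (add_nonneg h1 h2) fun h0 => ?_
      have h3 : a * π₁ h * g₁ h z s = 0 := by linarith
      have h4 : b * π₂ h * g₂ h z s = 0 := by linarith
      have h5 := (mul_eq_zero.1 h3).resolve_right (hg₁ h z s).ne'
      have h6 := (mul_eq_zero.1 h4).resolve_right (hg₂ h z s).ne'
      simp only [hπ, h5, h6] at hp
      simp at hp
    · exact hg₁ h z s
  · intro h z
    dsimp only
    split_ifs with hp
    · rw [← Finset.sum_div, div_le_one hp, Finset.sum_add_distrib, ← Finset.mul_sum,
        ← Finset.mul_sum]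
      exact add_le_add (mul_le_of_le_one_right (mul_nonneg ha (hπ₁ h)) (hg₁' h z))
        (mul_le_of_le_one_right (mul_nonneg hb (hπ₂ h)) (hg₂' h z))
    · exact hg₁' h z
  · intro c
    have h1 : (a • v₁ + b • v₂) c ≤ a * progress CE ev E w f π₁ g₁ c +
        b * progress CE ev E w f π₂ g₂ c := by
      simp only [Pi.add_apply, Pi.smul_apply, smul_eq_mul]
      exact add_le_add (mul_le_mul_of_nonneg_left (hv₁ c) ha) (mul_le_mul_of_nonneg_left (hv₂ c) hb)
    refine h1.trans ?_
    simp only [progress]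
    rw [Finset.mul_sum, Finset.mul_sum, ← Finset.sum_add_distrib]
    refine Finset.sum_le_sum fun h _ => ?_
    rcases (hπ0 h).eq_or_lt with h0 | hp
    · have h3 : a * π₁ h = 0 := by
        have := mul_nonneg ha (hπ₁ h); have := mul_nonneg hb (hπ₂ h); simp only [hπ] at h0; linarith
      have h4 : b * π₂ h = 0 := by
        have := mul_nonneg ha (hπ₁ h); have := mul_nonneg hb (hπ₂ h); simp only [hπ] at h0; linarith
      rw [← mul_assoc, ← mul_assoc, h3, h4, ← h0]
      simp
    simp only [hp, if_true]
    have hA : ∀ (p : ℝ) (g : Z → S → ℝ), p * (1 - ∑ z, CE h c z + ∑ z, CE h c z *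
        (Real.log (g z (E c)) - Real.log (w (E c)) + 2 * mismatch (ev c z) (f (E c) z))) =
        p * (1 - ∑ z, CE h c z + ∑ z, CE h c z *
          (- Real.log (w (E c)) + 2 * mismatch (ev c z) (f (E c) z))) +
        ∑ z, CE h c z * (p * Real.log (g z (E c))) := by
      intro p g
      have : ∑ z, CE h c z * (p * Real.log (g z (E c))) =
          p * ∑ z, CE h c z * Real.log (g z (E c)) := by
        rw [Finset.mul_sum]; exact Finset.sum_congr rfl fun z _ => by ring
      rw [this, ← mul_add, add_assoc (1 - ∑ z, CE h c z), ← Finset.sum_add_distrib]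
      congr 2
      exact Finset.sum_congr rfl fun z _ => by ring
    rw [hA (π₁ h) (g₁ h), hA (π₂ h) (g₂ h),
      hA (π h) (fun z s => (a * π₁ h * g₁ h z s + b * π₂ h * g₂ h z s) / π h)]
    have hB : a * ∑ z, CE h c z * (π₁ h * Real.log (g₁ h z (E c))) +
        b * ∑ z, CE h c z * (π₂ h * Real.log (g₂ h z (E c))) ≤ ∑ z, CE h c z * (π h *
          Real.log ((a * π₁ h * g₁ h z (E c) + b * π₂ h * g₂ h z (E c)) / π h)) := by
      rw [Finset.mul_sum, Finset.mul_sum, ← Finset.sum_add_distrib]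
      refine Finset.sum_le_sum fun z _ => ?_
      have := mul_le_mul_of_nonneg_left (mul_log_add_le ha hb (hπ₁ h) (hπ₂ h) (hg₁ h z (E c))
        (hg₂ h z (E c)) hp) (hCE h c z)
      linarith
    simp only [hπ] at hB ⊢
    linarith

/-- In every round the learner has a query distribution and a reweighting of the experts that make
progress against all targets simultaneously. -/
theorem exists_uniform_progress [Fintype Y] [Nonempty I] (CE : I → I → Z → ℝ) (hCE : ∀ h c z, 0 ≤ CE h c z)
    (hsum : ∀ h c, ∑ z, CE h c z ≤ 1) (hsym : ∀ h c z, CE h c z = CE c h z)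
    (ev : I → Z → Y) (hdis : ∀ h c z, CE h c z ≠ 0 → ev h z ≠ ev c z)
    (E : I → S) (w : S → ℝ) (hw : ∀ s, 0 < w s) (hw1 : ∑ s, w s ≤ 1) (f : S → Z → Y)
    (hk : 0 < Fintype.card Y) :
    ∃ (π : I → ℝ) (g : I → Z → S → ℝ), (∀ h, 0 ≤ π h) ∧ ∑ h, π h = 1 ∧
      (∀ h z s, 0 < g h z s) ∧ (∀ h z, ∑ s, g h z s ≤ 1) ∧
      ∀ c, 1 / (4 * Fintype.card Y : ℝ) ≤ progress CE ev E w f π g c := by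
  have hkp : (0 : ℝ) < Fintype.card Y := by exact_mod_cast hk
  obtain ⟨v, ⟨π, g, h1, h2, h3, h4, h5⟩, hv⟩ := exists_forall_lt_of_forall_prior
    (convex_progress CE hCE ev E w f) (b := 1 / (4 * Fintype.card Y : ℝ))
    (b' := 3 / (8 * Fintype.card Y : ℝ)) (by rw [div_lt_div_iff₀ (by positivity) (by positivity)]
                                             linarith) (by
      intro μ hμ hμ1
      obtain ⟨g, hg, hg1, hp⟩ := exists_bayes_action CE hCE hsum hsym ev hdis E w hw hw1 f hk μ hμ hμ1
      exact ⟨progress CE ev E w f μ g, ⟨μ, g, hμ, hμ1, hg, hg1, fun c => le_rfl⟩, hp⟩)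
  exact ⟨π, g, h1, h2, h3, h4, fun c => (hv c).le.trans (h5 c)⟩

end Round


/-! ### The law of the interaction -/

section Law

variable {X : Type u} {Y : Type v} [MeasurableSpace X] {H : Finset (X → Y)}

theorem measurable_finSnoc {α : Type*} [MeasurableSpace α] (n : ℕ) :
    Measurable (fun p : (Fin n → α) × α => (Fin.snoc p.1 p.2 : Fin (n + 1) → α)) := by
  rw [measurable_pi_iff]
  intro i
  refine Fin.lastCases ?_ (fun j => ?_) i
  · simpa using measurable_snd
  · simp only [Fin.snoc_castSucc]
    fun_prop

instance Generator.isFiniteKernel_response (A : Generator H) (c : Hyp H) (n : ℕ) :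
    IsFiniteKernel (A.response c n) := by
  classical
  refine ⟨1, ENNReal.one_lt_top, fun p => ?_⟩
  change (if p.2 = c then (0 : Measure X) else A.reject (fun i => (p.1 i).1) p.2 c) Set.univ ≤ 1
  split_ifs with h
  · simp
  · exact A.mass_le_one _ _ _ h

theorem Generator.response_self (A : Generator H) (c : Hyp H) (n : ℕ) (τ : Fin n → Hyp H × X) :
    A.response c n (τ, c) = 0 := by
  exact if_pos rfl

theorem Generator.response_of_ne (A : Generator H) {h c : Hyp H} (hne : h ≠ c) (n : ℕ)
    (τ : Fin n → Hyp H × X) :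
    A.response c n (τ, h) = A.reject (fun i => (τ i).1) h c := by
  exact if_neg hne

instance Learner.isMarkovKernel_query (L : Learner H) (n : ℕ) : IsMarkovKernel (L.query n) :=
  L.isMarkov n

instance isFiniteMeasure_rejectedLaw (A : Generator H) (L : Learner H) (c : Hyp H) (n : ℕ) :
    IsFiniteMeasure (rejectedLaw A L c n) := by
  induction n with
  | zero => unfold rejectedLaw; infer_instance
  | succ n ih => unfold rejectedLaw; infer_instance

theorem rejectedLaw_zero_univ (A : Generator H) (L : Learner H) (c : Hyp H) :
    rejectedLaw A L c 0 Set.univ = 1 := by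
  unfold rejectedLaw; simp

theorem lintegral_rejectedLaw_zero (A : Generator H) (L : Learner H) (c : Hyp H)
    {Φ : (Fin 0 → Hyp H × X) → ℝ≥0∞} (hΦ : Measurable Φ) :
    ∫⁻ τ, Φ τ ∂(rejectedLaw A L c 0) = Φ (fun i => i.elim0) := by
  unfold rejectedLaw
  rw [lintegral_dirac' _ hΦ]

theorem lintegral_rejectedLaw_succ (A : Generator H) (L : Learner H) (c : Hyp H) (n : ℕ)
    {Φ : (Fin (n + 1) → Hyp H × X) → ℝ≥0∞} (hΦ : Measurable Φ) :
    ∫⁻ τ, Φ τ ∂(rejectedLaw A L c (n + 1)) =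
      ∫⁻ τ, ∫⁻ h, ∫⁻ x, Φ (Fin.snoc τ (h, x)) ∂(A.response c n (τ, h)) ∂(L.query n τ)
        ∂(rejectedLaw A L c n) := by
  rw [rejectedLaw, lintegral_map hΦ (measurable_finSnoc n),
    Measure.lintegral_compProd (f := fun p => Φ (Fin.snoc p.1 p.2))
      (hΦ.comp (measurable_finSnoc n))]
  refine lintegral_congr fun τ => ?_
  rw [Kernel.lintegral_compProd]
  exact hΦ.comp ((measurable_finSnoc n).comp measurable_prodMk_left)

/-- A potential that drops by `δ` in expectation in every round bounds the number of queries. -/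
theorem mul_expectedQueries_le_of_drift (A : Generator H) (L : Learner H) (c : Hyp H) (δ : ℝ≥0∞)
    (Φ : (n : ℕ) → (Fin n → Hyp H × X) → ℝ≥0∞) (hΦ : ∀ n, Measurable (Φ n))
    (hdrift : ∀ n τ, ∫⁻ h, ∫⁻ x, Φ (n + 1) (Fin.snoc τ (h, x)) ∂(A.response c n (τ, h))
      ∂(L.query n τ) + δ ≤ Φ n τ) :
    δ * expectedQueries A L c ≤ Φ 0 (fun i => i.elim0) := by
  have key : ∀ N : ℕ, ∫⁻ τ, Φ N τ ∂(rejectedLaw A L c N) +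
      ∑ n ∈ Finset.range N, δ * rejectedLaw A L c n Set.univ ≤ Φ 0 (fun i => i.elim0) := by
    intro N
    induction N with
    | zero => simp [lintegral_rejectedLaw_zero A L c (hΦ 0)]
    | succ N ih =>
      refine le_trans ?_ ih
      rw [Finset.sum_range_succ, lintegral_rejectedLaw_succ A L c N (hΦ _), add_comm (∑ n ∈ _, _),
        ← add_assoc]
      gcongr
      rw [← lintegral_const, ← lintegral_add_right _ measurable_const]
      exact lintegral_mono fun τ => hdrift N τ
  rw [expectedQueries, ← ENNReal.tsum_mul_left, ENNReal.tsum_eq_iSup_nat]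
  exact iSup_le fun N => le_trans le_add_self (key N)

/-! ### The number of queries against a dominated generator -/

/-- An exact generator accepts only the target, so the mass lost in a round is the probability of
querying `c`. -/
theorem rejectedLaw_univ_eq_add (A : Generator H) (hA : A.IsExact) (L : Learner H) (c : Hyp H)
    (n : ℕ) : rejectedLaw A L c n Set.univ =
      rejectedLaw A L c (n + 1) Set.univ + ∫⁻ τ, L.query n τ {c} ∂(rejectedLaw A L c n) := by
  classical
  have h1 : rejectedLaw A L c (n + 1) Set.univ =
      ∫⁻ τ, L.query n τ {c}ᶜ ∂(rejectedLaw A L c n) := by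
    rw [← lintegral_one, lintegral_rejectedLaw_succ A L c n measurable_const]
    refine lintegral_congr fun τ => ?_
    rw [← lintegral_indicator_one (MeasurableSet.of_discrete)]
    refine lintegral_congr fun h => ?_
    rw [lintegral_one]
    by_cases hc : h = c
    · subst hc
      simp [A.response_self]
    · have := hA (fun i => (τ i).1) h c hc
      rw [A.response_of_ne hc]
      simp [hc]
  rw [h1, ← lintegral_add_left ((L.query n).measurable_coe MeasurableSet.of_discrete),
    ← lintegral_one]
  refine lintegral_congr fun τ => ?_
  rw [add_comm, measure_add_measure_compl MeasurableSet.of_discrete, measure_univ]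

/-- The law of the transcript of the first `n` rounds when the learner `L` is fed with independent
samples from `ν` in place of counterexamples. -/
noncomputable def sampledLaw (L : Learner H) (ν : Measure X) :
    (n : ℕ) → Measure (Fin n → Hyp H × X)
  | 0 => Measure.dirac (fun i => i.elim0)
  | n + 1 => ((sampledLaw L ν n) ⊗ₘ (L.query n ⊗ₖ Kernel.const _ ν)).map
      (fun p => (Fin.snoc p.1 p.2 : Fin (n + 1) → Hyp H × X))

instance isProbabilityMeasure_sampledLaw (L : Learner H) (ν : Measure X) [IsProbabilityMeasure ν]
    (n : ℕ) : IsProbabilityMeasure (sampledLaw L ν n) := by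
  induction n with
  | zero => unfold sampledLaw; infer_instance
  | succ n ih =>
    unfold sampledLaw
    exact Measure.isProbabilityMeasure_map (measurable_finSnoc n).aemeasurable

theorem lintegral_sampledLaw_succ (L : Learner H) (ν : Measure X) [IsProbabilityMeasure ν] (n : ℕ)
    {Φ : (Fin (n + 1) → Hyp H × X) → ℝ≥0∞} (hΦ : Measurable Φ) :
    ∫⁻ τ, Φ τ ∂(sampledLaw L ν (n + 1)) =
      ∫⁻ τ, ∫⁻ h, ∫⁻ x, Φ (Fin.snoc τ (h, x)) ∂ν ∂(L.query n τ) ∂(sampledLaw L ν n) := by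
  rw [sampledLaw, lintegral_map hΦ (measurable_finSnoc n),
    Measure.lintegral_compProd (f := fun p => Φ (Fin.snoc p.1 p.2))
      (hΦ.comp (measurable_finSnoc n))]
  refine lintegral_congr fun τ => ?_
  rw [Kernel.lintegral_compProd]
  · rfl
  · exact hΦ.comp ((measurable_finSnoc n).comp measurable_prodMk_left)

/-- Change of measure, one factor `β` per round. The gain is that `sampledLaw` does not depend on
`c`. -/
theorem lintegral_rejectedLaw_le (A : Generator H) (L : Learner H) (c : Hyp H) (ν : Measure X)
    [IsProbabilityMeasure ν] (β : ℝ≥0∞)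
    (hβ : ∀ {n : ℕ} (past : Fin n → Hyp H) (h : Hyp H), h ≠ c → A.reject past h c ≤ β • ν) (n : ℕ)
    {Φ : (Fin n → Hyp H × X) → ℝ≥0∞} (hΦ : Measurable Φ) :
    ∫⁻ τ, Φ τ ∂(rejectedLaw A L c n) ≤ β ^ n * ∫⁻ τ, Φ τ ∂(sampledLaw L ν n) := by
  induction n with
  | zero =>
    unfold rejectedLaw sampledLaw
    simp
  | succ n ih =>
    have hm : Measurable (fun p : (Fin n → Hyp H × X) × Hyp H =>
        ∫⁻ x, Φ (Fin.snoc p.1 (p.2, x)) ∂ν) := by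
      refine Measurable.lintegral_prod_right'
        (f := fun q : ((Fin n → Hyp H × X) × Hyp H) × X => Φ (Fin.snoc q.1.1 (q.1.2, q.2))) ?_
      exact hΦ.comp ((measurable_finSnoc n).comp (by fun_prop :
        Measurable (fun q : ((Fin n → Hyp H × X) × Hyp H) × X => (q.1.1, (q.1.2, q.2)))))
    have hm2 : Measurable (fun τ : Fin n → Hyp H × X =>
        ∫⁻ h, ∫⁻ x, Φ (Fin.snoc τ (h, x)) ∂ν ∂(L.query n τ)) :=
      Measurable.lintegral_kernel_prod_right' (κ := L.query n) hm
    rw [lintegral_rejectedLaw_succ A L c n hΦ, lintegral_sampledLaw_succ L ν n hΦ]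
    calc _ ≤ ∫⁻ τ, β * ∫⁻ h, ∫⁻ x, Φ (Fin.snoc τ (h, x)) ∂ν ∂(L.query n τ)
          ∂(rejectedLaw A L c n) := by
          refine lintegral_mono fun τ => ?_
          rw [← lintegral_const_mul _ Measurable.of_discrete]
          refine lintegral_mono fun h => ?_
          dsimp only
          by_cases hc : h = c
          · subst hc
            simp [A.response_self]
          · rw [A.response_of_ne hc]
            refine (lintegral_mono' (hβ _ _ hc) le_rfl).trans ?_
            rw [lintegral_smul_measure, smul_eq_mul]
      _ = β * ∫⁻ τ, ∫⁻ h, ∫⁻ x, Φ (Fin.snoc τ (h, x)) ∂ν ∂(L.query n τ)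
          ∂(rejectedLaw A L c n) := lintegral_const_mul _ hm2
      _ ≤ β * (β ^ n * _) := by
          gcongr
          exact ih hm2
      _ = _ := by rw [pow_succ', mul_assoc]

/-- If all laws of counterexamples are dominated by `β • ν`, then at most `β ^ n` of the targets, in
total probability, are found in round `n + 1`. -/
theorem card_le_sum_rejectedLaw_add [Fintype (Hyp H)] (A : Generator H) (hA : A.IsExact)
    (L : Learner H) (ν : Measure X) [IsProbabilityMeasure ν] (β : ℝ≥0∞)
    (hβ : ∀ {n : ℕ} (past : Fin n → Hyp H) (h c : Hyp H), h ≠ c → A.reject past h c ≤ β • ν)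
    (n : ℕ) : (Fintype.card (Hyp H) : ℝ≥0∞) ≤
      ∑ c, rejectedLaw A L c n Set.univ + ∑ t ∈ Finset.range n, β ^ t := by
  induction n with
  | zero => simp [rejectedLaw_zero_univ]
  | succ n ih =>
    refine ih.trans ?_
    have h1 : ∑ c, ∫⁻ τ, L.query n τ {c} ∂(rejectedLaw A L c n) ≤ β ^ n := by
      calc _ ≤ ∑ c, β ^ n * ∫⁻ τ, L.query n τ {c} ∂(sampledLaw L ν n) := by
            refine Finset.sum_le_sum fun c _ => ?_
            exact lintegral_rejectedLaw_le A L c ν β (fun past h hc => hβ past h c hc) n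
              ((L.query n).measurable_coe MeasurableSet.of_discrete)
        _ = β ^ n := by
            rw [← Finset.mul_sum, ← lintegral_finsetSum _ fun c _ =>
              (L.query n).measurable_coe MeasurableSet.of_discrete]
            -- Under the common law `sampledLaw` the events of querying the different targets are
            -- disjoint.
            have : ∀ τ, ∑ c, L.query n τ {c} = 1 := by
              intro τ
              rw [sum_measure_singleton]
              simp
            simp [this]
    rw [Finset.sum_congr rfl fun c _ => rejectedLaw_univ_eq_add A hA L c n,
      Finset.sum_add_distrib, Finset.sum_range_succ, add_assoc, add_comm (∑ t ∈ Finset.range n, β ^ t)]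
    exact add_le_add le_rfl (add_le_add_left h1 _)

theorem exists_le_expectedQueries [Fintype (Hyp H)] [Nonempty (Hyp H)] (A : Generator H)
    (hA : A.IsExact) (L : Learner H) (ν : Measure X) [IsProbabilityMeasure ν] (β : ℝ) (hβ1 : 1 ≤ β)
    (hβ : ∀ {n : ℕ} (past : Fin n → Hyp H) (h c : Hyp H), h ≠ c →
      A.reject past h c ≤ ENNReal.ofReal β • ν)
    (N : ℕ) (hN : ∑ t ∈ Finset.range N, β ^ t ≤ Fintype.card (Hyp H) / 2) :
    ∃ c, ENNReal.ofReal ((N + 1) / 2) ≤ expectedQueries A L c := by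
  classical
  by_contra! hcon
  set K : ℝ := (Fintype.card (Hyp H) : ℝ) with hK
  have hKp : 0 < K := Nat.cast_pos.2 Fintype.card_pos
  have h1 : ∀ n ∈ Finset.range (N + 1), ENNReal.ofReal (K / 2) ≤
      ∑ c, rejectedLaw A L c n Set.univ := by
    intro n hn
    have h2 := card_le_sum_rejectedLaw_add A hA L ν _ hβ n
    have h3 : ∑ t ∈ Finset.range n, ENNReal.ofReal β ^ t ≤ ENNReal.ofReal (K / 2) := by
      calc _ = ENNReal.ofReal (∑ t ∈ Finset.range n, β ^ t) := by
            rw [ENNReal.ofReal_sum_of_nonneg fun t _ => by positivity]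
            exact Finset.sum_congr rfl fun t _ => (ENNReal.ofReal_pow (by linarith) t).symm
        _ ≤ _ := by
            apply ENNReal.ofReal_le_ofReal
            refine le_trans ?_ hN
            apply Finset.sum_le_sum_of_subset_of_nonneg
            · exact Finset.range_mono (Nat.lt_succ_iff.1 (Finset.mem_range.1 hn))
            · intros; positivity
    have h4 : (Fintype.card (Hyp H) : ℝ≥0∞) = ENNReal.ofReal (K / 2) + ENNReal.ofReal (K / 2) := by
      rw [← ENNReal.ofReal_add (by positivity) (by positivity), add_halves, hK,
        ENNReal.ofReal_natCast]
    rw [h4] at h2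
    exact (ENNReal.add_le_add_iff_right ENNReal.ofReal_ne_top).1
      (h2.trans (add_le_add le_rfl h3))
  -- For each of the `N + 1` values `n ≤ N` the average target is still unfound with probability at
  -- least `1/2`.
  have h5 : ∑ n ∈ Finset.range (N + 1), ENNReal.ofReal (K / 2) ≤ ∑ c, expectedQueries A L c := by
    refine (Finset.sum_le_sum h1).trans ?_
    rw [Finset.sum_comm]
    refine Finset.sum_le_sum fun c _ => ?_
    exact ENNReal.sum_le_tsum _
  have h6 : ∑ c, expectedQueries A L c < ∑ c : Hyp H, ENNReal.ofReal ((N + 1) / 2 : ℝ) :=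
    ENNReal.sum_lt_sum_of_nonempty Finset.univ_nonempty fun c _ => hcon c
  have h7 := h5.trans_lt h6
  simp only [Finset.sum_const, Finset.card_range, Finset.card_univ, ← ENNReal.ofReal_nsmul] at h7
  refine absurd h7 (not_lt.2 (ENNReal.ofReal_le_ofReal (le_of_eq ?_)))
  simp only [nsmul_eq_mul, ← hK]
  push_cast
  ring

end Law


/-! ### Littlestone dimension -/

section Ldim

variable {X : Type u} {Y : Type v}

theorem MistakeTree.IsShattered.mono {n : ℕ} {T : MistakeTree X Y n} {V W : Finset (X → Y)}
    (h : T.IsShattered V) (hVW : V ⊆ W) : T.IsShattered W := fun b => by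
  obtain ⟨f, hf, hfb⟩ := h b
  exact ⟨f, hVW hf, hfb⟩

theorem MistakeTree.IsShattered.le_ldim {n : ℕ} {T : MistakeTree X Y n} {V : Finset (X → Y)}
    (h : T.IsShattered V) : (n : ℕ∞) ≤ ldim V :=
  le_iSup₂_of_le (f := fun (m : ℕ) (_ : m ∈ {n : ℕ | ∃ T : MistakeTree X Y n, T.IsShattered V}) =>
    (m : ℕ∞)) n ⟨T, h⟩ le_rfl

theorem ldim_le {V : Finset (X → Y)} {d : ℕ∞}
    (h : ∀ (n : ℕ) (T : MistakeTree X Y n), T.IsShattered V → (n : ℕ∞) ≤ d) : ldim V ≤ d :=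
  iSup₂_le fun n ⟨T, hT⟩ => h n T hT

theorem ldim_mono {V W : Finset (X → Y)} (h : V ⊆ W) : ldim V ≤ ldim W :=
  ldim_le fun _ _ hT => (hT.mono h).le_ldim

theorem isShattered_leaf {V : Finset (X → Y)} (hV : V.Nonempty) :
    (MistakeTree.leaf : MistakeTree X Y 0).IsShattered V := fun _ => by
  obtain ⟨f, hf⟩ := hV
  exact ⟨f, hf, trivial⟩

theorem MistakeTree.IsShattered.nonempty {n : ℕ} {T : MistakeTree X Y n} {V : Finset (X → Y)}
    (h : T.IsShattered V) : V.Nonempty := by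
  obtain ⟨f, hf, _⟩ := h fun _ => true
  exact ⟨f, hf⟩

/-- Nonemptiness is needed for `d = 0`: the empty class has dimension `0` but shatters no tree, not
even a leaf. -/
theorem exists_isShattered_of_ldim_eq {V : Finset (X → Y)} (hV : V.Nonempty) {d : ℕ}
    (h : ldim V = d) : ∃ T : MistakeTree X Y d, T.IsShattered V := by
  by_contra hcon
  cases d with
  | zero => exact hcon ⟨.leaf, isShattered_leaf hV⟩
  | succ d =>
    have : ldim V ≤ d := by
      refine ldim_le fun n T hT => ?_
      have h1 := hT.le_ldim
      rw [h] at h1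
      have h2 : n ≤ d + 1 := by exact_mod_cast h1
      have h3 : n ≠ d + 1 := by
        rintro rfl
        exact hcon ⟨T, hT⟩
      exact_mod_cast (by omega : n ≤ d)
    rw [h] at this
    have : d + 1 ≤ d := by exact_mod_cast this
    omega

open Classical in
/-- The functions in `V` that take the value `y` at `x`. -/
noncomputable def restrict (V : Finset (X → Y)) (x : X) (y : Y) : Finset (X → Y) :=
  V.filter fun h => h x = y

theorem mem_restrict {V : Finset (X → Y)} {x : X} {y : Y} {h : X → Y} :
    h ∈ restrict V x y ↔ h ∈ V ∧ h x = y := by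
  classical exact Finset.mem_filter

theorem restrict_subset (V : Finset (X → Y)) (x : X) (y : Y) : restrict V x y ⊆ V :=
  fun _ h => (mem_restrict.1 h).1

theorem isShattered_node {V : Finset (X → Y)} {n : ℕ} {x : X} {label : Bool → Y}
    (hl : label false ≠ label true) {child : Bool → MistakeTree X Y n}
    (h : ∀ i, (child i).IsShattered (restrict V x (label i))) :
    (MistakeTree.node x label hl child).IsShattered V := fun b => by
  obtain ⟨f, hf, hfb⟩ := h (b 0) fun i => b i.succ
  rw [mem_restrict] at hf
  exact ⟨f, hf.1, hf.2, hfb⟩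

theorem MistakeTree.IsShattered.child {V : Finset (X → Y)} {n : ℕ} {x : X} {label : Bool → Y}
    {hl : label false ≠ label true} {child : Bool → MistakeTree X Y n}
    (h : (MistakeTree.node x label hl child).IsShattered V) (i : Bool) :
    (child i).IsShattered (restrict V x (label i)) := fun b => by
  obtain ⟨f, hf, hfb⟩ := h (Fin.cons i b)
  simp only [MistakeTree.Follows, Fin.cons_zero, Fin.cons_succ] at hfb
  exact ⟨f, mem_restrict.2 ⟨hf, hfb.1⟩, hfb.2⟩

/-- The Littlestone dimension as a natural number. -/
noncomputable def ldimNat (V : Finset (X → Y)) : ℕ := (ldim V).toNat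

theorem coe_ldimNat {V : Finset (X → Y)} (h : ldim V ≠ ⊤) : (ldimNat V : ℕ∞) = ldim V :=
  ENat.natCast_toNat h

theorem ldimNat_mono {V W : Finset (X → Y)} (hW : ldim W ≠ ⊤) (h : V ⊆ W) :
    ldimNat V ≤ ldimNat W :=
  ENat.toNat_le_toNat (ldim_mono h) hW

open Classical in
/-- The prediction of the standard optimal algorithm at `x`: a label whose restriction of the
version space `V` is nonempty and of the largest possible Littlestone dimension. -/
noncomputable def soaLabel [Fintype Y] [Nonempty Y] (V : Finset (X → Y)) (x : X) : Y :=
  (Finset.exists_max_image Finset.univ (fun y : Y =>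
    if (restrict V x y).Nonempty then ldimNat (restrict V x y) + 1 else 0)
    Finset.univ_nonempty).choose

/-- If the restriction by `h x` kept the full dimension, so would the one by the optimal label. Two
trees of depth `ldimNat V` could then be joined under a root at `x`. -/
theorem ldimNat_restrict_lt [Fintype Y] [Nonempty Y] {V : Finset (X → Y)} (hV : ldim V ≠ ⊤)
    {h : X → Y} (hh : h ∈ V) {x : X} (hx : h x ≠ soaLabel V x) :
    ldimNat (restrict V x (h x)) < ldimNat V := by
  classical
  by_contra hcon
  have hne : (restrict V x (h x)).Nonempty := ⟨h, mem_restrict.2 ⟨hh, rfl⟩⟩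
  have hfin : ∀ y, ldim (restrict V x y) ≠ ⊤ := fun y =>
    ne_top_of_le_ne_top hV (ldim_mono (restrict_subset V x y))
  have h1 := (Finset.exists_max_image Finset.univ (fun y : Y =>
    if (restrict V x y).Nonempty then ldimNat (restrict V x y) + 1 else 0)
    Finset.univ_nonempty).choose_spec.2 (h x) (Finset.mem_univ _)
  change _ ≤ (if (restrict V x (soaLabel V x)).Nonempty then
    ldimNat (restrict V x (soaLabel V x)) + 1 else 0) at h1
  rw [if_pos hne] at h1
  -- The `+ 1` in the score makes an empty restriction lose to any nonempty one, even of dimension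
  -- `0`.
  split_ifs at h1 with h2
  swap
  · omega
  have h3 := ldimNat_mono hV (restrict_subset V x (h x))
  have h4 := ldimNat_mono hV (restrict_subset V x (soaLabel V x))
  obtain ⟨T₁, hT₁⟩ := exists_isShattered_of_ldim_eq (d := ldimNat V) hne (by
    rw [← coe_ldimNat (hfin _)]; congr 1; omega)
  obtain ⟨T₂, hT₂⟩ := exists_isShattered_of_ldim_eq (d := ldimNat V) h2 (by
    rw [← coe_ldimNat (hfin _)]; congr 1; omega)
  have h5 : (MistakeTree.node x (fun b => if b then h x else soaLabel V x) (by simpa using hx.symm)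
      (fun b => if b then T₁ else T₂)).IsShattered V := by
    refine isShattered_node _ fun i => ?_
    cases i
    · simpa using hT₂
    · simpa using hT₁
  have h6 := h5.le_ldim
  rw [← coe_ldimNat hV] at h6
  have : ldimNat V + 1 ≤ ldimNat V := by exact_mod_cast h6
  omega

theorem two_le_card_of_ldim_pos [Fintype Y] {V : Finset (X → Y)} {d : ℕ} (hd : 1 ≤ d)
    (h : ldim V = d) : V.Nonempty ∧ 2 ≤ Fintype.card Y := by
  by_contra hcon
  have : ldim V ≤ 0 := by
    refine ldim_le fun n T hT => ?_
    cases T with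
    | leaf => simp
    | node x label hl child =>
      exact absurd ⟨hT.nonempty, Fintype.one_lt_card_iff.2 ⟨_, _, hl⟩⟩ hcon
  rw [h] at this
  have : d ≤ 0 := by exact_mod_cast this
  omega

end Ldim


/-! ### Upper bound: reduction to finitely many instances -/

section Pattern

variable {X : Type u} {Y : Type v}

noncomputable instance Hyp.fintype (H : Finset (X → Y)) : Fintype (Hyp H) := Fintype.ofFinite _

/-- The patterns of values that the members of `H` take at a point. -/
def Pattern (H : Finset (X → Y)) : Type (max u v) :=
  Set.range fun (x : X) (h : Hyp H) => h.1 x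

variable {H : Finset (X → Y)}

instance Pattern.finite [Finite Y] : Finite (Pattern H) :=
  inferInstanceAs (Finite (Set.range fun (x : X) (h : Hyp H) => h.1 x))

noncomputable instance Pattern.fintype [Finite Y] : Fintype (Pattern H) := Fintype.ofFinite _

instance : MeasurableSpace (Pattern H) := ⊤

instance : DiscreteMeasurableSpace (Pattern H) := ⟨fun _ => trivial⟩

/-- The pattern of values at `x`. -/
def patternOf (H : Finset (X → Y)) (x : X) : Pattern H := ⟨fun h => h.1 x, x, rfl⟩

/-- A point at which a given pattern occurs. -/
noncomputable def Pattern.rep (z : Pattern H) : X := z.2.choose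

theorem Pattern.apply_rep (z : Pattern H) (h : Hyp H) : h.1 z.rep = z.1 h :=
  congrFun z.2.choose_spec h

theorem apply_rep_patternOf (h : Hyp H) (x : X) : h.1 (patternOf H x).rep = h.1 x :=
  (patternOf H x).apply_rep h

theorem measurable_patternOf [MeasurableSpace X] [Finite Y]
    (hH : ∀ h ∈ H, ∀ y : Y, MeasurableSet {x : X | h x = y}) : Measurable (patternOf H) := by
  refine measurable_to_countable' fun z => ?_
  have : patternOf H ⁻¹' {z} = ⋂ h : Hyp H, {x | h.1 x = z.1 h} := by
    ext x
    simp only [Set.mem_preimage, Set.mem_singleton_iff, Set.mem_iInter, Set.mem_ofPred_eq]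
    exact ⟨fun h i => by rw [← h]; rfl, fun h => Subtype.ext (funext h)⟩
  rw [this]
  exact MeasurableSet.iInter fun h => hH h.1 h.2 _

open Classical in
/-- The law of the pattern of the counterexample. -/
noncomputable def patternLaw [MeasurableSpace X] (A : Generator H) {n : ℕ} (past : Fin n → Hyp H)
    (h c : Hyp H) (z : Pattern H) : ℝ :=
  -- Zero on the diagonal encodes that the target is accepted, and extends symmetry and disagreement
  -- to `h = c`.
  if h = c then 0 else (A.reject past h c (patternOf H ⁻¹' {z})).toReal

theorem patternLaw_nonneg [MeasurableSpace X] (A : Generator H) {n : ℕ} (past : Fin n → Hyp H)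
    (h c : Hyp H) (z : Pattern H) : 0 ≤ patternLaw A past h c z := by
  unfold patternLaw
  split_ifs
  · exact le_rfl
  · exact ENNReal.toReal_nonneg

theorem patternLaw_symm [MeasurableSpace X] {A : Generator H} (hA : A.IsSymmetric) {n : ℕ}
    (past : Fin n → Hyp H) (h c : Hyp H) (z : Pattern H) :
    patternLaw A past h c z = patternLaw A past c h z := by
  unfold patternLaw
  by_cases hc : h = c
  · simp [hc]
  · rw [if_neg hc, if_neg (Ne.symm hc), hA past h c hc]

theorem sum_patternLaw_le_one [MeasurableSpace X] [Finite Y]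
    (hH : ∀ h ∈ H, ∀ y : Y, MeasurableSet {x : X | h x = y}) (A : Generator H) {n : ℕ}
    (past : Fin n → Hyp H) (h c : Hyp H) : ∑ z, patternLaw A past h c z ≤ 1 := by
  unfold patternLaw
  by_cases hc : h = c
  · simp [hc]
  · simp only [if_neg hc]
    have h1 := A.mass_le_one past h c hc
    have h2 : ∑ z, A.reject past h c (patternOf H ⁻¹' {z}) ≤ 1 := by
      refine le_trans (le_of_eq ?_) h1
      have := sum_measure_singleton (μ := (A.reject past h c).map (patternOf H))
        (s := Finset.univ)
      rw [Finset.coe_univ, Measure.map_apply (measurable_patternOf hH) MeasurableSet.univ,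
        Set.preimage_univ] at this
      rw [← this]
      refine Finset.sum_congr rfl fun z _ => ?_
      rw [Measure.map_apply (measurable_patternOf hH) MeasurableSet.of_discrete]
    rw [← ENNReal.toReal_sum fun z _ => ne_top_of_le_ne_top ENNReal.one_ne_top
      ((measure_mono (Set.subset_univ _)).trans h1)]
    exact ENNReal.toReal_le_of_le_ofReal zero_le_one (by simpa using h2)

theorem ne_of_patternLaw_ne_zero [MeasurableSpace X] (A : Generator H) {n : ℕ}
    (past : Fin n → Hyp H) (h c : Hyp H) (z : Pattern H) (hz : patternLaw A past h c z ≠ 0) :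
    h.1 z.rep ≠ c.1 z.rep := by
  intro heq
  apply hz
  unfold patternLaw
  split_ifs with hc
  · rfl
  · have h1 := A.disagree past h c hc
    rw [ae_iff] at h1
    have h2 : A.reject past h c (patternOf H ⁻¹' {z}) = 0 := by
      refine measure_mono_null ?_ h1
      intro x hx
      simp only [Set.mem_preimage, Set.mem_singleton_iff] at hx
      simp only [Set.mem_ofPred_eq, not_not]
      rw [← hx, apply_rep_patternOf, apply_rep_patternOf] at heq
      exact heq
    simp [h2]

end Pattern

/-! ### Upper bound: the learner -/

section Experts

variable {X : Type u} {Y : Type v} {H : Finset (X → Y)}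

/-- The labels of `c` at the counterexamples of the transcript `τ`. -/
noncomputable def labels {n : ℕ} (τ : Fin n → Hyp H × Pattern H) (c : Hyp H) : Fin n → Y :=
  fun i => c.1 (τ i).2.rep

open Classical in
/-- The members of `H` whose labels at the counterexamples of `τ` are `σ`. -/
noncomputable def version {n : ℕ} (τ : Fin n → Hyp H × Pattern H) (σ : Fin n → Y) :
    Finset (X → Y) :=
  H.filter fun h => ∀ i, h (τ i).2.rep = σ i

theorem mem_version {n : ℕ} {τ : Fin n → Hyp H × Pattern H} {σ : Fin n → Y} {h : X → Y} :
    h ∈ version τ σ ↔ h ∈ H ∧ ∀ i, h (τ i).2.rep = σ i := by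
  classical exact Finset.mem_filter

theorem version_subset {n : ℕ} (τ : Fin n → Hyp H × Pattern H) (σ : Fin n → Y) :
    version τ σ ⊆ H := fun _ h => (mem_version.1 h).1

theorem mem_version_labels {n : ℕ} (τ : Fin n → Hyp H × Pattern H) (c : Hyp H) :
    c.1 ∈ version τ (labels τ c) :=
  mem_version.2 ⟨c.2, fun _ => rfl⟩

theorem labels_snoc {n : ℕ} (τ : Fin n → Hyp H × Pattern H) (h : Hyp H) (z : Pattern H)
    (c : Hyp H) : labels (Fin.snoc τ (h, z) : Fin (n + 1) → Hyp H × Pattern H) c =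
      (Fin.snoc (labels τ c) (c.1 z.rep) : Fin (n + 1) → Y) := by
  ext i
  refine Fin.lastCases ?_ (fun j => ?_) i <;> simp [labels]

theorem version_snoc {n : ℕ} (τ : Fin n → Hyp H × Pattern H) (h : Hyp H) (z : Pattern H)
    (σ : Fin n → Y) (y : Y) :
    version (Fin.snoc τ (h, z) : Fin (n + 1) → Hyp H × Pattern H)
      (Fin.snoc σ y : Fin (n + 1) → Y) = restrict (version τ σ) z.rep y := by
  ext f
  simp [mem_version, mem_restrict, Fin.forall_fin_succ', and_assoc]

variable [Fintype Y]

/-- Positive weights of total mass at most one on the label sequences of length `n`. -/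
def Weights (Y : Type v) [Fintype Y] (n : ℕ) : Type v :=
  {w : (Fin n → Y) → ℝ // (∀ s, 0 < w s) ∧ ∑ s, w s ≤ 1}

theorem Weights.le_one {n : ℕ} (w : Weights Y n) (s : Fin n → Y) : w.1 s ≤ 1 :=
  (Finset.single_le_sum (fun i _ => (w.2.1 i).le) (Finset.mem_univ s)).trans w.2.2

/-- The potential of the target `c`. -/
noncomputable def potential {n : ℕ} (τ : Fin n → Hyp H × Pattern H) (w : Weights Y n) (c : Hyp H) :
    ℝ :=
  -- The summand `1` keeps the potential at least `1`, so that an acceptance, after which it counts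
  -- as `0`, is a drop of at least `1`.
  1 - Real.log (w.1 (labels τ c)) +
    10 * Real.log (Fintype.card Y) * ldimNat (version τ (labels τ c))

theorem one_le_potential {n : ℕ} (τ : Fin n → Hyp H × Pattern H) (w : Weights Y n) (c : Hyp H) :
    1 ≤ potential τ w c := by
  have h1 : Real.log (w.1 (labels τ c)) ≤ 0 := Real.log_nonpos (w.2.1 _).le (w.le_one _)
  have h2 : 0 ≤ 10 * Real.log (Fintype.card Y) * ldimNat (version τ (labels τ c)) := by
    have := Real.log_natCast_nonneg (Fintype.card Y)
    positivity
  unfold potential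
  linarith

theorem sum_snoc {n : ℕ} (F : (Fin (n + 1) → Y) → ℝ) :
    ∑ σ, F σ = ∑ s : Fin n → Y, ∑ y : Y, F (Fin.snoc s y) := by
  rw [← (Fin.snocEquiv fun _ : Fin (n + 1) => Y).sum_comp, Fintype.sum_prod_type, Finset.sum_comm]
  rfl

/-- Every expert `s` passes its weight on to its extensions, and most of it to the extension by its
prediction. -/
theorem exists_split_weights (hk : 2 ≤ Fintype.card Y) {n : ℕ} (g : (Fin n → Y) → ℝ)
    (hg : ∀ s, 0 < g s) (hg1 : ∑ s, g s ≤ 1) (f : (Fin n → Y) → Y) :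
    ∃ w : Weights Y (n + 1), ∀ s y,
      (y = f s → Real.log (g s) - 1 / (8 * Fintype.card Y) ≤ Real.log (w.1 (Fin.snoc s y))) ∧
      (y ≠ f s → Real.log (g s) - 6 * Real.log (Fintype.card Y) ≤
        Real.log (w.1 (Fin.snoc s y))) := by
  classical
  set k : ℝ := (Fintype.card Y : ℝ) with hkdef
  have hk2 : (2 : ℝ) ≤ k := by rw [hkdef]; exact_mod_cast hk
  have hkp : 0 < k := by linarith
  -- With this `ε`, `log (1 - ε) ≥ -2ε = -1/(8k)` and `log (ε / k) = -log (16 k²) ≥ -6 log k`, the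
  -- latter by `k ≥ 2`.
  set ε : ℝ := 1 / (16 * k) with hε
  have hε0 : 0 < ε := by positivity
  have hε2 : ε ≤ 1 / 2 := by
    rw [hε]; apply one_div_le_one_div_of_le <;> linarith
  refine ⟨⟨fun σ => g (Fin.init σ) * if σ (Fin.last n) = f (Fin.init σ) then 1 - ε else ε / k,
    fun σ => mul_pos (hg _) ?_, ?_⟩, fun s y => ⟨fun hy => ?_, fun hy => ?_⟩⟩
  · split_ifs
    · linarith
    · positivity
  · rw [sum_snoc]
    simp only [Fin.init_snoc, Fin.snoc_last, ← Finset.mul_sum]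
    refine le_trans (Finset.sum_le_sum fun s _ => ?_) hg1
    refine mul_le_of_le_one_right (hg s).le ?_
    calc ∑ y, (if y = f s then 1 - ε else ε / k)
        ≤ ∑ y, ((if y = f s then 1 - ε else 0) + ε / k) := by
          refine Finset.sum_le_sum fun y _ => ?_
          have : 0 < ε / k := by positivity
          split_ifs <;> linarith
      _ = 1 := by
          rw [Finset.sum_add_distrib, Finset.sum_ite_eq', Finset.sum_const, Finset.card_univ,
            nsmul_eq_mul, ← hkdef]
          simp only [Finset.mem_univ, if_true]
          field_simp
          ring
  · simp only [Fin.init_snoc, Fin.snoc_last, hy, if_true]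
    rw [Real.log_mul (hg s).ne' (by linarith)]
    have h1 := Real.one_sub_inv_le_log_of_pos (show 0 < 1 - ε by linarith)
    have h2 : 1 - (1 - ε)⁻¹ - -(1 / (8 * k)) = ε * (1 - 2 * ε) / (1 - ε) := by
      have : 1 - ε ≠ 0 := by linarith
      have h3 : 1 / (8 * k) = 2 * ε := by rw [hε]; field_simp; norm_num
      rw [h3]
      field_simp
      ring
    have h3 : 0 ≤ ε * (1 - 2 * ε) / (1 - ε) :=
      div_nonneg (mul_nonneg hε0.le (by linarith)) (by linarith)
    linarith
  · simp only [Fin.init_snoc, Fin.snoc_last, hy, if_false]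
    rw [Real.log_mul (hg s).ne' (by positivity)]
    have h1 : ε / k = (2 ^ 4 * k ^ 2)⁻¹ := by
      rw [hε]; field_simp; norm_num
    rw [h1, Real.log_inv, Real.log_mul (by norm_num) (by positivity), Real.log_pow, Real.log_pow]
    have h2 : Real.log 2 ≤ Real.log k := Real.log_le_log (by norm_num) hk2
    push_cast
    linarith

variable [MeasurableSpace X]

/-- One round of the learner. -/
theorem exists_round (hH : ∀ h ∈ H, ∀ y : Y, MeasurableSet {x : X | h x = y})
    (hne : H.Nonempty) (hk : 2 ≤ Fintype.card Y) (hd : ldim H ≠ ⊤) {A : Generator H}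
    (hA : A.IsSymmetric) (n : ℕ) (τ : Fin n → Hyp H × Pattern H) (w : Weights Y n) :
    ∃ (π : Hyp H → ℝ) (next : Hyp H → Pattern H → Weights Y (n + 1)), (∀ h, 0 ≤ π h) ∧
      ∑ h, π h = 1 ∧ ∀ c, ∑ h, π h * ∑ z, patternLaw A (fun i => (τ i).1) h c z *
        potential (Fin.snoc τ (h, z)) (next h z) c + 1 / (8 * Fintype.card Y : ℝ) ≤
          potential τ w c := by
  classical
  have : Nonempty (Hyp H) := ⟨⟨hne.choose, hne.choose_spec⟩⟩
  have : Nonempty Y := Fintype.card_pos_iff.1 (by omega)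
  obtain ⟨π, g, hπ, hπ1, hg, hg1, hprog⟩ := exists_uniform_progress
    (patternLaw A fun i => (τ i).1) (patternLaw_nonneg A _) (sum_patternLaw_le_one hH A _)
    (patternLaw_symm hA _) (fun h z => h.1 z.rep) (ne_of_patternLaw_ne_zero A _) (labels τ)
    w.1 w.2.1 w.2.2 (fun s z => soaLabel (version τ s) z.rep) (by omega)
  choose next hnext using fun (h : Hyp H) (z : Pattern H) => exists_split_weights hk (g h z)
    (hg h z) (hg1 h z) (fun s => soaLabel (version τ s) z.rep)
  refine ⟨π, next, hπ, hπ1, fun c => ?_⟩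
  set k : ℝ := (Fintype.card Y : ℝ) with hkdef
  have hk2 : (2 : ℝ) ≤ k := by rw [hkdef]; exact_mod_cast hk
  have hkp : 0 < k := by linarith
  have hlog : 0.69 ≤ Real.log k := by
    have h1 : Real.log 2 ≤ Real.log k := Real.log_le_log (by norm_num) hk2
    have h2 := Real.log_two_gt_d9
    linarith
  set P := potential τ w c with hP
  have hP1 : 1 ≤ P := one_le_potential τ w c
  set δ : ℝ := 1 / (8 * k) with hδ
  have hδ0 : 0 < δ := by positivity
  set D : Pattern H → ℝ := fun z =>
    mismatch (c.1 z.rep) (soaLabel (version τ (labels τ c)) z.rep) with hD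
  have hpot : ∀ h z, potential (Fin.snoc τ (h, z)) (next h z) c ≤
      P + δ - (Real.log (g h z (labels τ c)) - Real.log (w.1 (labels τ c)) + 2 * D z) := by
    intro h z
    have hV : ldim (version τ (labels τ c)) ≠ ⊤ :=
      ne_top_of_le_ne_top hd (ldim_mono (version_subset _ _))
    rw [hP]
    unfold potential
    rw [labels_snoc, version_snoc, ← hkdef]
    obtain ⟨h1, h2⟩ := hnext h z (labels τ c) (c.1 z.rep)
    by_cases hy : c.1 z.rep = soaLabel (version τ (labels τ c)) z.rep
    · have h3 := h1 hy
      have h4 : D z = 0 := by simp [hD, mismatch, hy]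
      have h5 : (ldimNat (restrict (version τ (labels τ c)) z.rep (c.1 z.rep)) : ℝ) ≤
          ldimNat (version τ (labels τ c)) :=
        Nat.cast_le.2 (ldimNat_mono hV (restrict_subset _ _ _))
      have h6 := mul_le_mul_of_nonneg_left h5 (show 0 ≤ 10 * Real.log k by linarith)
      rw [h4]
      linarith
    · have h3 := h2 hy
      have h4 : D z = 1 := by simp [hD, mismatch, hy]
      have h5 : (ldimNat (restrict (version τ (labels τ c)) z.rep (c.1 z.rep)) : ℝ) + 1 ≤
          ldimNat (version τ (labels τ c)) := by
        exact_mod_cast ldimNat_restrict_lt hV (mem_version_labels τ c) hy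
      -- A mistake gains `10 log k` from the dimension and loses `6 log k` in the split. The
      -- remaining `4 log k` exceeds the `2` credited for it in `progress`.
      have h6 := mul_le_mul_of_nonneg_left h5 (show 0 ≤ 10 * Real.log k by linarith)
      rw [h4]
      linarith
  have hsumz : ∀ h, ∑ z, patternLaw A (fun i => (τ i).1) h c z *
      potential (Fin.snoc τ (h, z)) (next h z) c ≤ P + δ -
      (1 - ∑ z, patternLaw A (fun i => (τ i).1) h c z + ∑ z, patternLaw A (fun i => (τ i).1) h c z *
        (Real.log (g h z (labels τ c)) - Real.log (w.1 (labels τ c)) + 2 * D z)) := by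
    intro h
    have h1 := Finset.sum_le_sum fun z (_ : z ∈ Finset.univ) =>
      mul_le_mul_of_nonneg_left (hpot h z) (patternLaw_nonneg A (fun i => (τ i).1) h c z)
    refine h1.trans ?_
    simp only [mul_sub, Finset.sum_sub_distrib, ← Finset.sum_mul]
    have h2 := sum_patternLaw_le_one hH A (fun i => (τ i).1) h c
    -- The acceptance mass is multiplied by `P + δ ≥ 1`.
    nlinarith
  have hfin := Finset.sum_le_sum fun h (_ : h ∈ Finset.univ) =>
      mul_le_mul_of_nonneg_left (hsumz h) (hπ h)
  simp only [mul_sub (π _) (P + δ), Finset.sum_sub_distrib, ← Finset.sum_mul, hπ1] at hfin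
  have hp := hprog c
  unfold progress at hp
  have h2δ : 1 / (4 * k) = 2 * δ := by rw [hδ]; field_simp; norm_num
  rw [h2δ] at hp
  linarith

end Experts

/-! ### Assembling the learner from its rounds, and the bound on its queries -/

section UpperBound

/-- The transcript with the counterexamples replaced by their patterns. -/
def patternHistory {X : Type u} {Y : Type v} {H : Finset (X → Y)} {n : ℕ} (τ : Fin n → Hyp H × X) : Fin n → Hyp H × Pattern H :=
  fun i => ((τ i).1, patternOf H (τ i).2)

theorem patternHistory_snoc {X : Type u} {Y : Type v} {H : Finset (X → Y)} {n : ℕ} (τ : Fin n → Hyp H × X) (h : Hyp H) (x : X) :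
    patternHistory (Fin.snoc τ (h, x) : Fin (n + 1) → Hyp H × X) =
      (Fin.snoc (patternHistory τ) (h, patternOf H x) : Fin (n + 1) → Hyp H × Pattern H) := by
  ext1 i
  refine Fin.lastCases ?_ (fun j => ?_) i <;> simp [patternHistory]

variable {X : Type u} {Y : Type v} [MeasurableSpace X] {H : Finset (X → Y)} [Fintype Y]

theorem measurable_patternHistory (hH : ∀ h ∈ H, ∀ y : Y, MeasurableSet {x : X | h x = y})
    (n : ℕ) : Measurable (patternHistory : (Fin n → Hyp H × X) → _) := by
  have := measurable_patternOf hH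
  unfold patternHistory
  fun_prop

/-- The learner that draws its queries from `π`, given the patterns of the counterexamples. -/
noncomputable def patternLearner (hH : ∀ h ∈ H, ∀ y : Y, MeasurableSet {x : X | h x = y})
    (π : (n : ℕ) → (Fin n → Hyp H × Pattern H) → Hyp H → ℝ) (hπ : ∀ n τ h, 0 ≤ π n τ h)
    (hπ1 : ∀ n τ, ∑ h, π n τ h = 1) : Learner H where
  query n :=
    { toFun := fun τ => ∑ h, ENNReal.ofReal (π n (patternHistory τ) h) • Measure.dirac h
      measurable' := (Measurable.of_discrete (f := fun τ : Fin n → Hyp H × Pattern H =>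
        ∑ h, ENNReal.ofReal (π n τ h) • Measure.dirac h)).comp (measurable_patternHistory hH n) }
  isMarkov n := ⟨fun τ => ⟨by
    change (∑ h, ENNReal.ofReal (π n (patternHistory τ) h) • Measure.dirac h :
      Measure (Hyp H)) Set.univ = 1
    simp only [Measure.coe_finsetSum, Finset.sum_apply, Measure.smul_apply, measure_univ,
      smul_eq_mul, mul_one]
    rw [← ENNReal.ofReal_sum_of_nonneg fun h _ => hπ n _ h, hπ1, ENNReal.ofReal_one]⟩⟩

theorem lintegral_patternLearner (hH : ∀ h ∈ H, ∀ y : Y, MeasurableSet {x : X | h x = y})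
    (π : (n : ℕ) → (Fin n → Hyp H × Pattern H) → Hyp H → ℝ) (hπ : ∀ n τ h, 0 ≤ π n τ h)
    (hπ1 : ∀ n τ, ∑ h, π n τ h = 1) (n : ℕ) (τ : Fin n → Hyp H × X) (F : Hyp H → ℝ≥0∞) :
    ∫⁻ h, F h ∂((patternLearner hH π hπ hπ1).query n τ) =
      ∑ h, ENNReal.ofReal (π n (patternHistory τ) h) * F h := by
  change ∫⁻ h, F h ∂(∑ h, ENNReal.ofReal (π n (patternHistory τ) h) • Measure.dirac h) = _
  rw [lintegral_finsetSum_measure]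
  simp

theorem lintegral_response (hH : ∀ h ∈ H, ∀ y : Y, MeasurableSet {x : X | h x = y})
    (A : Generator H) (c h : Hyp H) {n : ℕ} (τ : Fin n → Hyp H × X) (F : Pattern H → ℝ)
    (hF : ∀ z, 0 ≤ F z) :
    ∫⁻ x, ENNReal.ofReal (F (patternOf H x)) ∂(A.response c n (τ, h)) =
      ENNReal.ofReal (∑ z, patternLaw A (fun i => (τ i).1) h c z * F z) := by
  by_cases hc : h = c
  · subst hc
    simp [A.response_self, patternLaw]
  · rw [A.response_of_ne hc, ← lintegral_map (f := fun z => ENNReal.ofReal (F z))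
      Measurable.of_discrete (measurable_patternOf hH), lintegral_fintype,
      ENNReal.ofReal_sum_of_nonneg fun z _ => mul_nonneg (patternLaw_nonneg A _ h c z) (hF z)]
    refine Finset.sum_congr rfl fun z _ => ?_
    rw [Measure.map_apply (measurable_patternOf hH) MeasurableSet.of_discrete, mul_comm,
      ENNReal.ofReal_mul (patternLaw_nonneg A _ h c z)]
    congr 1
    unfold patternLaw
    rw [if_neg hc, ENNReal.ofReal_toReal]
    exact ne_top_of_le_ne_top ENNReal.one_ne_top
      ((measure_mono (Set.subset_univ _)).trans (A.mass_le_one _ h c hc))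

theorem exists_learner_expectedQueries_le
    (hH : ∀ h ∈ H, ∀ y : Y, MeasurableSet {x : X | h x = y}) {d : ℕ} (hd : 1 ≤ d)
    (hdim : ldim H = d) {A : Generator H} (hA : A.IsSymmetric) :
    ∃ L : Learner H, ∀ c : Hyp H, expectedQueries A L c ≤
      ENNReal.ofReal (96 * d * Fintype.card Y * Real.log (Fintype.card Y)) := by
  obtain ⟨hne, hk⟩ := two_le_card_of_ldim_pos hd hdim
  choose π next hπ hπ1 hdrift using exists_round hH hne hk (by rw [hdim]; simp) hA
  -- The weights are a function of the transcript, computed recursively from mass `1` on the empty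
  -- label sequence.
  let W : (n : ℕ) → (Fin n → Hyp H × Pattern H) → Weights Y n := fun n =>
    Nat.rec (fun _ => ⟨fun _ => 1, by simp, by simp⟩)
      (fun n W τ => next n (Fin.init τ) (W (Fin.init τ)) (τ (Fin.last n)).1 (τ (Fin.last n)).2) n
  have hW : ∀ n (τ : Fin n → Hyp H × Pattern H) h z,
      W (n + 1) (Fin.snoc τ (h, z)) = next n τ (W n τ) h z := by
    intro n τ h z
    change next n (Fin.init (Fin.snoc τ (h, z) : Fin (n + 1) → Hyp H × Pattern H))
      (W n (Fin.init (Fin.snoc τ (h, z) : Fin (n + 1) → Hyp H × Pattern H)))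
      ((Fin.snoc τ (h, z) : Fin (n + 1) → Hyp H × Pattern H) (Fin.last n)).1
      ((Fin.snoc τ (h, z) : Fin (n + 1) → Hyp H × Pattern H) (Fin.last n)).2 = _
    rw [Fin.init_snoc, Fin.snoc_last]
  refine ⟨patternLearner hH (fun n τ => π n τ (W n τ)) (fun n τ => hπ n τ (W n τ))
    (fun n τ => hπ1 n τ (W n τ)), fun c => ?_⟩
  set k : ℝ := (Fintype.card Y : ℝ) with hkdef
  have hk2 : (2 : ℝ) ≤ k := by rw [hkdef]; exact_mod_cast hk
  have hkp : 0 < k := by linarith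
  set δ : ℝ := 1 / (8 * k) with hδ
  have hδ0 : 0 < δ := by positivity
  have key := mul_expectedQueries_le_of_drift A (patternLearner hH (fun n τ => π n τ (W n τ))
    (fun n τ => hπ n τ (W n τ)) (fun n τ => hπ1 n τ (W n τ))) c (ENNReal.ofReal δ)
    (fun n τ => ENNReal.ofReal (potential (patternHistory τ) (W n (patternHistory τ)) c))
    (fun n => (Measurable.of_discrete (f := fun τ : Fin n → Hyp H × Pattern H =>
      ENNReal.ofReal (potential τ (W n τ) c))).comp (measurable_patternHistory hH n)) (by
    intro n τ
    have hnn : ∀ h z, 0 ≤ potential (Fin.snoc (patternHistory τ) (h, z))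
        (next n (patternHistory τ) (W n (patternHistory τ)) h z) c :=
      fun h z => zero_le_one.trans (one_le_potential _ _ _)
    simp only [patternHistory_snoc, hW]
    rw [lintegral_patternLearner]
    have h1 : ∀ h, ∫⁻ x, ENNReal.ofReal (potential (Fin.snoc (patternHistory τ) (h, patternOf H x))
        (next n (patternHistory τ) (W n (patternHistory τ)) h (patternOf H x)) c)
        ∂(A.response c n (τ, h)) = _ := fun h => lintegral_response hH A c h τ
          (fun z => potential (Fin.snoc (patternHistory τ) (h, z))
            (next n (patternHistory τ) (W n (patternHistory τ)) h z) c) (hnn h)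
    simp only [h1]
    rw [Finset.sum_congr rfl fun h _ => (ENNReal.ofReal_mul (hπ n (patternHistory τ)
      (W n (patternHistory τ)) h)).symm, ← ENNReal.ofReal_sum_of_nonneg, ← ENNReal.ofReal_add]
    · exact ENNReal.ofReal_le_ofReal (hdrift n (patternHistory τ) (W n (patternHistory τ)) c)
    · exact Finset.sum_nonneg fun h _ => mul_nonneg (hπ _ _ _ h) (Finset.sum_nonneg fun z _ =>
        mul_nonneg (patternLaw_nonneg _ _ _ _ _) (hnn h z))
    · exact hδ0.le
    · exact fun h _ => mul_nonneg (hπ _ _ _ h) (Finset.sum_nonneg fun z _ =>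
        mul_nonneg (patternLaw_nonneg _ _ _ _ _) (hnn h z)))
  have h0 : ∀ τ : Fin 0 → Hyp H × Pattern H, potential τ (W 0 τ) c = 1 + 10 * Real.log k * d := by
    intro τ
    have h1 : version τ (labels τ c) = H := by
      ext h
      simp [mem_version]
    have h2 : ldimNat H = d := by
      rw [ldimNat, hdim]; rfl
    have h3 : (W 0 τ).1 (labels τ c) = 1 := rfl
    rw [potential, h1, h2, h3, Real.log_one, sub_zero]
  rw [h0] at key
  have hlog : 0.69 ≤ Real.log k := by
    have h1 : Real.log 2 ≤ Real.log k := Real.log_le_log (by norm_num) hk2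
    have h2 := Real.log_two_gt_d9
    linarith
  have hd1 : (1 : ℝ) ≤ d := by exact_mod_cast hd
  -- `96 / 8 = 12`, and the spare `2 d log k` absorbs the initial `1`.
  have hle : 1 + 10 * Real.log k * d ≤ δ * (96 * d * k * Real.log k) := by
    have : δ * (96 * d * k * Real.log k) = 12 * (Real.log k * d) := by
      rw [hδ]; field_simp; norm_num
    rw [this]
    nlinarith
  have h2 := key.trans (ENNReal.ofReal_le_ofReal hle)
  rw [ENNReal.ofReal_mul hδ0.le] at h2
  exact (ENNReal.mul_le_mul_iff_right (by simpa using hδ0) ENNReal.ofReal_ne_top).1 h2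

end UpperBound


/-! ### Lower bound: uniformly random counterexamples -/

section Uniform

theorem Hyp.exists_ne {X : Type u} {Y : Type v} {H : Finset (X → Y)} {h c : Hyp H} (hne : h ≠ c) :
    ∃ x, h.1 x ≠ c.1 x := by
  by_contra! hcon
  exact hne (Subtype.ext (funext hcon))

variable {X : Type u} {Y : Type v} [MeasurableSpace X] [DiscreteMeasurableSpace X] [Finite X]

theorem uniformGenerator_isSymmetric (H : Finset (X → Y)) : (uniformGenerator H).IsSymmetric := by
  intro n past h c _
  simp only [uniformGenerator, ne_comm]

theorem uniformGenerator_isExact (H : Finset (X → Y)) : (uniformGenerator H).IsExact := by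
  intro n past h c hne
  exact isProbabilityMeasure_uniformOn (Set.toFinite _) (Hyp.exists_ne hne)

theorem uniformOn_le_smul_uniformOn_univ {s : Set X} (hs : s.Nonempty) {β : ℝ} (hβ0 : 0 ≤ β)
    (hβ : (Nat.card X : ℝ) ≤ β * s.ncard) :
    uniformOn s ≤ ENNReal.ofReal β • uniformOn (Set.univ : Set X) := by
  have hcount : ∀ t : Set X, Measure.count t = (t.ncard : ℝ≥0∞) := fun t => by
    rw [Measure.count_apply_finite t (Set.toFinite t), Set.ncard_eq_toFinset_card]
  have : Nonempty X := ⟨hs.some⟩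
  have hX : (0 : ℝ) < Nat.card X := Nat.cast_pos.2 Nat.card_pos
  have hs0 : (0 : ℝ) < s.ncard := Nat.cast_pos.2 ((Set.ncard_pos (Set.toFinite s)).2 hs)
  refine Measure.le_intro fun t _ _ => ?_
  rw [Measure.smul_apply, smul_eq_mul, uniformOn, uniformOn,
    cond_apply MeasurableSet.of_discrete, cond_apply MeasurableSet.univ, Set.univ_inter, ← mul_assoc]
  refine mul_le_mul' ?_ (measure_mono Set.inter_subset_right)
  rw [hcount, hcount, Set.ncard_univ, ← ENNReal.ofReal_natCast, ← ENNReal.ofReal_natCast,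
    ← ENNReal.ofReal_inv_of_pos hs0, ← ENNReal.ofReal_inv_of_pos hX, ← ENNReal.ofReal_mul hβ0]
  apply ENNReal.ofReal_le_ofReal
  rw [← div_eq_mul_inv, le_div_iff₀ hX, inv_mul_le_iff₀ hs0, mul_comm]
  exact hβ

end Uniform

/-! ### Lower bound: linear functionals -/

section Linear

variable {p d : ℕ} [Fact p.Prime] {Y : Type v}

/-- All nodes at depth `i` carry the same point `x i`. -/
theorem exists_isShattered_of_forall_bool {X : Type u} {a b : Y} (hab : a ≠ b) {m : ℕ}
    (x : Fin m → X) (V : Finset (X → Y))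
    (h : ∀ s : Fin m → Bool, ∃ f ∈ V, ∀ i, f (x i) = if s i then b else a) :
    ∃ T : MistakeTree X Y m, T.IsShattered V := by
  induction m generalizing V with
  | zero =>
    obtain ⟨f, hf, _⟩ := h fun i => i.elim0
    exact ⟨.leaf, isShattered_leaf ⟨f, hf⟩⟩
  | succ m ih =>
    have h1 : ∀ i : Bool, ∃ T : MistakeTree X Y m,
        T.IsShattered (restrict V (x 0) (if i then b else a)) := by
      intro i
      refine ih (fun j => x j.succ) _ fun s => ?_
      obtain ⟨f, hf, hfs⟩ := h (Fin.cons i s)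
      refine ⟨f, mem_restrict.2 ⟨hf, by simpa using hfs 0⟩, fun j => ?_⟩
      simpa using hfs j.succ
    choose T hT using h1
    exact ⟨.node (x 0) (fun i => if i then b else a) (by simpa using hab) T, isShattered_node _ hT⟩

/-- The class lies in the coset `φ₀ + U`. Both children being nonempty, evaluation at the root is
nonzero on `U`, so the subclass of a child lies in a coset of the strictly smaller space `U ⊓ ker`.
Each level costs a dimension. -/
theorem isShattered_le_finrank {ι : ZMod p → Y} (hι : Function.Injective ι) {n : ℕ}
    (T : MistakeTree (Fin d → ZMod p) Y n) (V : Finset ((Fin d → ZMod p) → Y))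
    (U : Submodule (ZMod p) ((Fin d → ZMod p) →ₗ[ZMod p] ZMod p))
    (φ₀ : (Fin d → ZMod p) →ₗ[ZMod p] ZMod p) (hV : ∀ h ∈ V, ∃ φ, φ - φ₀ ∈ U ∧ h = ι ∘ φ)
    (hT : T.IsShattered V) : n ≤ Module.finrank (ZMod p) U := by
  induction T generalizing V U φ₀ with
  | leaf => exact Nat.zero_le _
  | @node n x label hl child ih =>
    obtain ⟨f₁, hf₁⟩ := (hT.child true).nonempty
    obtain ⟨f₂, hf₂⟩ := (hT.child false).nonempty
    rw [mem_restrict] at hf₁ hf₂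
    obtain ⟨φ₁, hφ₁, rfl⟩ := hV f₁ hf₁.1
    obtain ⟨φ₂, hφ₂, rfl⟩ := hV f₂ hf₂.1
    have hne : φ₁ x ≠ φ₂ x := by
      intro heq
      exact hl (hf₂.2.symm.trans ((congrArg ι heq.symm).trans hf₁.2))
    set U' := U ⊓ LinearMap.ker (LinearMap.applyₗ (R := ZMod p) (M₂ := ZMod p) x) with hU'
    have h1 : n ≤ Module.finrank (ZMod p) U' := by
      refine ih true (restrict V x (label true)) U' φ₁ (fun h hh => ?_) (hT.child true)
      rw [mem_restrict] at hh
      obtain ⟨φ, hφ, rfl⟩ := hV h hh.1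
      refine ⟨φ, ⟨?_, ?_⟩, rfl⟩
      · have := U.sub_mem hφ hφ₁
        simpa using this
      · have h2 : φ x = φ₁ x := hι (hh.2.trans hf₁.2.symm)
        simp [h2]
    have h2 : U' < U := by
      refine lt_of_le_of_ne inf_le_left fun heq => ?_
      have h3 : φ₁ - φ₂ ∈ U := by
        have := U.sub_mem hφ₁ hφ₂
        simpa using this
      rw [← heq, hU'] at h3
      have h4 : (φ₁ - φ₂) x = 0 := h3.2
      exact hne (sub_eq_zero.1 h4)
    have h3 := Submodule.finrank_lt_finrank_of_lt h2
    omega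

/-- A class of linear functionals, with its values relabelled by `ι`, has Littlestone dimension `d`
if it contains all functionals whose coefficients are `a` or `b`. -/
theorem ldim_eq_of_linear {ι : ZMod p → Y} (hι : Function.Injective ι)
    {H : Finset ((Fin d → ZMod p) → Y)}
    (hH : ∀ h ∈ H, ∃ φ : (Fin d → ZMod p) →ₗ[ZMod p] ZMod p, h = ι ∘ φ) {a b : ZMod p}
    (hab : a ≠ b) (hmem : ∀ v : Fin d → ZMod p, (∀ i, v i = a ∨ v i = b) →
      ι ∘ Fintype.linearCombination (ZMod p) v ∈ H) : ldim H = d := by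
  refine le_antisymm (ldim_le fun n T hT => ?_) ?_
  · have h1 := isShattered_le_finrank hι T H ⊤ 0 (fun h hh => by
      obtain ⟨φ, hφ⟩ := hH h hh
      exact ⟨φ, trivial, hφ⟩) hT
    rw [finrank_top] at h1
    have h2 : Module.finrank (ZMod p) ((Fin d → ZMod p) →ₗ[ZMod p] ZMod p) = d := by
      rw [Module.finrank_linearMap]
      simp
    rw [h2] at h1
    exact_mod_cast h1
  · obtain ⟨T, hT⟩ := exists_isShattered_of_forall_bool (hι.ne hab)
      (fun i : Fin d => (Pi.single i 1 : Fin d → ZMod p)) H (fun s => by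
        refine ⟨_, hmem (fun i => if s i then b else a) (fun i => ?_), fun i => ?_⟩
        · cases s i <;> simp
        · simp only [Function.comp_apply, Fintype.linearCombination_apply_single, one_smul]
          exact apply_ite ι _ _ _)
    exact hT.le_ldim

/-- The agreement set is the kernel of a nonzero functional, hence has index `p`. -/
theorem card_mul_ncard_ne {φ ψ : (Fin d → ZMod p) →ₗ[ZMod p] ZMod p} (hne : φ ≠ ψ) :
    p * {x | φ x ≠ ψ x}.ncard = (p - 1) * Nat.card (Fin d → ZMod p) := by
  set χ := φ - ψ with hχ
  have hχ0 : χ ≠ 0 := sub_ne_zero.2 hne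
  have hsurj : Function.Surjective χ := LinearMap.surjective hχ0
  have h1 : Nat.card (Fin d → ZMod p) = Nat.card (LinearMap.ker χ) * p := by
    rw [Submodule.card_eq_card_quotient_mul_card (LinearMap.ker χ),
      Nat.card_congr (χ.quotKerEquivOfSurjective hsurj).toEquiv, Nat.card_zmod]
  have h2 : {x | φ x ≠ ψ x} = (LinearMap.ker χ : Set (Fin d → ZMod p))ᶜ := by
    ext x
    simp [hχ, sub_eq_zero]
  have h3 := Set.ncard_add_ncard_compl (LinearMap.ker χ : Set (Fin d → ZMod p))
  have h4 : (LinearMap.ker χ : Set (Fin d → ZMod p)).ncard = Nat.card (LinearMap.ker χ) := rfl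
  rw [← h2, h4, h1] at h3
  rw [h1]
  have hp : 1 ≤ p := (Fact.out : p.Prime).one_lt.le
  obtain ⟨q, rfl⟩ := Nat.exists_eq_add_of_le hp
  have h5 : {x | φ x ≠ ψ x}.ncard = Nat.card (LinearMap.ker χ) * q := by
    have : Nat.card (LinearMap.ker χ) * (1 + q) =
      Nat.card (LinearMap.ker χ) + Nat.card (LinearMap.ker χ) * q := by ring
    omega
  rw [h5, Nat.add_sub_cancel_left]
  ring

/-- The geometric sum is `P ((1 + 1/P) ^ N - 1)`, and `(1 + 1/P) ^ N ≤ exp (N / P)`. -/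
theorem sum_pow_le {P K : ℝ} (hP : 0 < P) (hK : 2 * P ≤ K) :
    ∑ t ∈ Finset.range ⌊P * Real.log (K / (2 * P))⌋₊, (1 + 1 / P) ^ t ≤ K / 2 := by
  set N := ⌊P * Real.log (K / (2 * P))⌋₊ with hN
  have hlog : 0 ≤ Real.log (K / (2 * P)) :=
    Real.log_nonneg (by rw [le_div_iff₀ (by positivity)]; linarith)
  have hNle : (N : ℝ) ≤ P * Real.log (K / (2 * P)) := Nat.floor_le (by positivity)
  rw [geom_sum_eq (by have : 0 < 1 / P := by positivity
                      linarith)]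
  have h1 : (1 + 1 / P) ^ N ≤ K / (2 * P) := by
    calc (1 + 1 / P) ^ N ≤ Real.exp (1 / P) ^ N := by
          apply pow_le_pow_left₀ (by positivity)
          have := Real.add_one_le_exp (1 / P)
          linarith
      _ = Real.exp (N * (1 / P)) := (Real.exp_nat_mul _ _).symm
      _ ≤ Real.exp (Real.log (K / (2 * P))) := by
          apply Real.exp_le_exp.2
          rw [mul_one_div, div_le_iff₀ hP]
          linarith
      _ = K / (2 * P) := Real.exp_log (div_pos (by linarith) (by positivity))
  have h2 : ((1 + 1 / P) ^ N - 1) / (1 + 1 / P - 1) = P * ((1 + 1 / P) ^ N - 1) := by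
    rw [add_sub_cancel_left, div_div_eq_mul_div, div_one, mul_comm]
  have h3 : P * (K / (2 * P)) = K / 2 := by field_simp
  rw [h2, ← h3]
  apply mul_le_mul_of_nonneg_left _ hP.le
  linarith

/-- With `d = m + 2`, the ratio is at least `p ^ m (p + 1) / 2 ≥ p ^ (m + 1/2)`, and `m + 1/2 ≥
d/4`. -/
theorem log_ratio_lower_bound {p d : ℕ} (hp : 2 ≤ p) (hd : 2 ≤ d) {K : ℝ}
    (hK : (p : ℝ) ^ d - 1 ≤ K) : 2 * ((p : ℝ) - 1) ≤ K ∧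
      (d / 4 : ℝ) * Real.log p ≤ Real.log (K / (2 * (p - 1))) := by
  have hp2 : (2 : ℝ) ≤ p := by exact_mod_cast hp
  obtain ⟨m, rfl⟩ := Nat.exists_eq_add_of_le' hd
  have hpm : (1 : ℝ) ≤ (p : ℝ) ^ m := one_le_pow₀ (by linarith)
  have h1 : (p : ℝ) ^ m * ((p + 1) / 2) * (2 * (p - 1)) ≤ K := by
    refine le_trans ?_ hK
    rw [pow_add]
    nlinarith
  have h2 : (p : ℝ) ^ m * ((p + 1) / 2) ≤ K / (2 * (p - 1)) := by
    rwa [le_div_iff₀ (by linarith)]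
  have h3 : 1 ≤ (p : ℝ) ^ m * ((p + 1) / 2) := by nlinarith
  refine ⟨?_, ?_⟩
  · refine le_trans ?_ h1
    nlinarith
  · refine le_trans ?_ (Real.log_le_log (by linarith) h2)
    rw [Real.log_mul (by positivity) (by positivity), Real.log_pow]
    have hlog : 0 ≤ Real.log p := Real.log_nonneg (by linarith)
    have h4 : Real.log p / 2 ≤ Real.log ((p + 1) / 2) := by
      rw [div_le_iff₀ (by norm_num), mul_comm]
      have : (2 : ℝ) * Real.log ((p + 1) / 2) = Real.log (((p + 1) / 2) ^ 2) := by
        rw [Real.log_pow]; norm_num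
      rw [this]
      apply Real.log_le_log (by linarith)
      nlinarith [sq_nonneg ((p : ℝ) - 1)]
    have hm : (0 : ℝ) ≤ m := Nat.cast_nonneg m
    push_cast
    nlinarith [mul_nonneg hm hlog]

theorem exists_le_expectedQueries_of_linear (hd : 2 ≤ d) {ι : ZMod p → Y}
    (hι : Function.Injective ι) {H : Finset ((Fin d → ZMod p) → Y)}
    (hH : ∀ h ∈ H, ∃ φ : (Fin d → ZMod p) →ₗ[ZMod p] ZMod p, h = ι ∘ φ)
    (hcard : p ^ d - 1 ≤ H.card) (L : Learner H) :
    ∃ c, ENNReal.ofReal (d * (p - 1) / 8 * Real.log p) ≤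
      expectedQueries (uniformGenerator H) L c := by
  have hp : 2 ≤ p := (Fact.out : p.Prime).two_le
  have hp2 : (2 : ℝ) ≤ p := by exact_mod_cast hp
  have hcardH : Fintype.card (Hyp H) = H.card := by
    rw [← Nat.card_eq_fintype_card]
    exact Nat.card_eq_card_toFinset _ |>.trans (by simp)
  have hK : (p : ℝ) ^ d - 1 ≤ Fintype.card (Hyp H) := by
    rw [hcardH]
    have : p ^ d ≤ H.card + 1 := by omega
    have : (p : ℝ) ^ d ≤ H.card + 1 := by exact_mod_cast this
    linarith
  obtain ⟨hK2, hlog⟩ := log_ratio_lower_bound hp hd hK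
  have hP : (0 : ℝ) < p - 1 := by linarith
  have : Nonempty (Hyp H) := by
    rw [← Fintype.card_pos_iff, ← Nat.cast_pos (α := ℝ)]
    linarith
  obtain ⟨c, hc⟩ := exists_le_expectedQueries (uniformGenerator H) (uniformGenerator_isExact H) L
    (uniformOn Set.univ) (1 + 1 / ((p : ℝ) - 1)) (by
      have : 0 < 1 / ((p : ℝ) - 1) := by positivity
      linarith) (by
      intro n past h c hne
      obtain ⟨φ, hφ⟩ := hH h.1 h.2
      obtain ⟨ψ, hψ⟩ := hH c.1 c.2
      refine uniformOn_le_smul_uniformOn_univ (s := {x | h.1 x ≠ c.1 x}) (Hyp.exists_ne hne) (by positivity) ?_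
      have h1 : {x | h.1 x ≠ c.1 x} = {x | φ x ≠ ψ x} := by
        ext x
        simp [hφ, hψ, hι.eq_iff]
      have h2 : φ ≠ ψ := by
        rintro rfl
        exact hne (Subtype.ext (hφ.trans hψ.symm))
      have h3 := card_mul_ncard_ne h2
      have h4 : (p : ℝ) * ({x | φ x ≠ ψ x}.ncard : ℝ) =
          ((p : ℝ) - 1) * (Nat.card (Fin d → ZMod p) : ℝ) := by
        have := congrArg (Nat.cast (R := ℝ)) h3
        rw [Nat.cast_mul, Nat.cast_mul, Nat.cast_sub (by omega)] at this
        simpa using this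
      rw [h1]
      have h5 : (1 + 1 / ((p : ℝ) - 1)) = p / (p - 1) := by
        field_simp
        ring
      rw [h5, div_mul_eq_mul_div, h4, mul_div_cancel_left₀ _ hP.ne']) _
    (sum_pow_le hP hK2)
  refine ⟨c, le_trans (ENNReal.ofReal_le_ofReal ?_) hc⟩
  -- The `N + 1` in the bound on the queries undoes the rounding down in `N`.
  have h1 := (Nat.lt_floor_add_one
    (((p : ℝ) - 1) * Real.log (Fintype.card (Hyp H) / (2 * ((p : ℝ) - 1))))).le
  have h2 := mul_le_mul_of_nonneg_left hlog hP.le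
  linarith

theorem linearCombination_injective :
    Function.Injective fun v : Fin d → ZMod p =>
      (Fintype.linearCombination (ZMod p) v : (Fin d → ZMod p) →ₗ[ZMod p] ZMod p) := by
  intro v w h
  ext i
  have := congrArg (fun φ : (Fin d → ZMod p) →ₗ[ZMod p] ZMod p => φ (Pi.single i 1)) h
  simpa [Fintype.linearCombination_apply_single] using this

theorem mem_linearFunctionals {f : (Fin d → ZMod p) → ZMod p} : f ∈ linearFunctionals p d ↔
    ∃ φ : (Fin d → ZMod p) →ₗ[ZMod p] ZMod p, φ ≠ 0 ∧ f = ⇑φ := by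
  simp [linearFunctionals]

theorem linearCombination_mem_linearFunctionals {v : Fin d → ZMod p} (hv : v ≠ 0) :
    ⇑(Fintype.linearCombination (ZMod p) v : (Fin d → ZMod p) →ₗ[ZMod p] ZMod p) ∈
      linearFunctionals p d := by
  refine mem_linearFunctionals.2 ⟨_, fun h0 => hv ?_, rfl⟩
  apply linearCombination_injective (p := p) (d := d)
  dsimp only
  rw [h0]
  ext i
  simp [Fintype.linearCombination_apply]

theorem le_card_linearFunctionals : p ^ d - 1 ≤ (linearFunctionals p d).card := by
  classical
  have h1 : ((Finset.univ : Finset (Fin d → ZMod p)).erase 0).card = p ^ d - 1 := by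
    rw [Finset.card_erase_of_mem (Finset.mem_univ _), Finset.card_univ, Fintype.card_fun,
      ZMod.card, Fintype.card_fin]
  rw [← h1]
  refine Finset.card_le_card_of_injOn (fun v => ⇑(Fintype.linearCombination (ZMod p) v :
    (Fin d → ZMod p) →ₗ[ZMod p] ZMod p)) (fun v hv => ?_) fun v _ w _ h => ?_
  · exact linearCombination_mem_linearFunctionals (Finset.mem_erase.1 hv).1
  · exact linearCombination_injective (DFunLike.coe_injective h)

theorem ldim_linearFunctionals (hp : 3 ≤ p) (hd : 1 ≤ d) : ldim (linearFunctionals p d) = d := by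
  have h1 : (1 : ZMod p) ≠ 0 := one_ne_zero
  have h2 : (2 : ZMod p) ≠ 0 := by
    intro h
    have : ((2 : ℕ) : ZMod p) = 0 := by exact_mod_cast h
    rw [ZMod.natCast_eq_zero_iff] at this
    have := Nat.le_of_dvd (by norm_num) this
    omega
  -- Coefficients `1` and `2` are distinct and nonzero for `p ≥ 3`, so the shattering functionals
  -- avoid zero.
  refine ldim_eq_of_linear (ι := id) Function.injective_id (fun h hh => ?_) (a := 1) (b := 2)
    (fun h => ?_) fun v hv => ?_
  · obtain ⟨φ, _, hφ⟩ := mem_linearFunctionals.1 hh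
    exact ⟨φ, hφ⟩
  · apply h1
    have : (2 : ZMod p) = 1 + 1 := by norm_num
    rw [this] at h
    exact left_eq_add.1 h
  · refine linearCombination_mem_linearFunctionals fun h0 => ?_
    have h3 := hv ⟨0, hd⟩
    rw [h0] at h3
    rcases h3 with h | h
    · exact h1 h.symm
    · exact h2 h.symm

theorem exists_le_expectedQueries_linearFunctionals (hd : 2 ≤ d)
    (L : Learner (linearFunctionals p d)) : ∃ c, ENNReal.ofReal (1 / 64 * d * p * Real.log p) ≤
      expectedQueries (uniformGenerator (linearFunctionals p d)) L c := by
  obtain ⟨c, hc⟩ := exists_le_expectedQueries_of_linear hd (ι := id) Function.injective_id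
    (fun h hh => by
      obtain ⟨φ, _, hφ⟩ := mem_linearFunctionals.1 hh
      exact ⟨φ, hφ⟩) le_card_linearFunctionals L
  refine ⟨c, le_trans (ENNReal.ofReal_le_ofReal ?_) hc⟩
  have hp2 : (2 : ℝ) ≤ p := by exact_mod_cast (Fact.out : p.Prime).two_le
  refine mul_le_mul_of_nonneg_right ?_ (Real.log_nonneg (by linarith))
  have hd0 : (0 : ℝ) ≤ d := Nat.cast_nonneg d
  nlinarith

/-- All linear functionals, with their values relabelled by `ι`. -/
noncomputable def relabelledFunctionals (d : ℕ) [Finite Y] (ι : ZMod p → Y) :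
    Finset ((Fin d → ZMod p) → Y) :=
  (Set.toFinite {f : (Fin d → ZMod p) → Y |
    ∃ φ : (Fin d → ZMod p) →ₗ[ZMod p] ZMod p, f = ι ∘ φ}).toFinset

theorem mem_relabelledFunctionals [Finite Y] {ι : ZMod p → Y} {f : (Fin d → ZMod p) → Y} :
    f ∈ relabelledFunctionals d ι ↔ ∃ φ : (Fin d → ZMod p) →ₗ[ZMod p] ZMod p, f = ι ∘ φ := by
  simp [relabelledFunctionals]

/-- Since the zero functional belongs to this class, coefficients `0` and `1` are allowed, which
covers `p = 2`. -/
theorem ldim_relabelledFunctionals [Finite Y] {ι : ZMod p → Y} (hι : Function.Injective ι) :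
    ldim (relabelledFunctionals d ι) = d :=
  ldim_eq_of_linear hι (fun _ hh => mem_relabelledFunctionals.1 hh) zero_ne_one
    fun _ _ => mem_relabelledFunctionals.2 ⟨_, rfl⟩

theorem le_card_relabelledFunctionals [Finite Y] {ι : ZMod p → Y} (hι : Function.Injective ι) :
    p ^ d - 1 ≤ (relabelledFunctionals d ι).card := by
  refine (Nat.sub_le _ _).trans ?_
  have h1 : (Finset.univ : Finset (Fin d → ZMod p)).card = p ^ d := by
    rw [Finset.card_univ, Fintype.card_fun, ZMod.card, Fintype.card_fin]
  rw [← h1]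
  refine Finset.card_le_card_of_injOn (fun v => ι ∘ (Fintype.linearCombination (ZMod p) v :
    (Fin d → ZMod p) →ₗ[ZMod p] ZMod p)) (fun v _ => ?_) fun v _ w _ h => ?_
  · exact mem_relabelledFunctionals.2 ⟨_, rfl⟩
  · exact linearCombination_injective (DFunLike.coe_injective (hι.comp_left h))

end Linear

/-- For every number of labels there is a class against which uniformly random counterexamples
force many queries. -/
theorem exists_class_le_expectedQueries {k d : ℕ} (hk : 2 ≤ k) (hd : 2 ≤ d) :
    ∃ (X : Type) (_ : MeasurableSpace X) (_ : DiscreteMeasurableSpace X)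
      (Y : Type) (_ : Fintype Y) (H : Finset (X → Y)) (A : Generator H),
      Fintype.card Y = k ∧ ldim H = d ∧ A.IsSymmetric ∧ A.IsExact ∧
      ∀ L : Learner H, ∃ c : Hyp H,
        ENNReal.ofReal (1 / 64 * d * k * Real.log k) ≤ expectedQueries A L c := by
  -- Bertrand's postulate gives a prime with `p ≤ k ≤ 2p`. Then `p - 1 ≥ p/2 ≥ k/4` and `log k ≤ log
  -- (p²)`, which yields the constant `1/64`.
  obtain ⟨p, hp, hp1, hp2⟩ := Nat.exists_prime_lt_and_le_two_mul (k / 2) (by omega)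
  have : Fact p.Prime := ⟨hp⟩
  have hpk : p ≤ k := by omega
  obtain ⟨ι⟩ : Nonempty (ZMod p ↪ Fin k) :=
    Function.Embedding.nonempty_of_card_le (by simpa [ZMod.card] using hpk)
  refine ⟨Fin d → ZMod p, inferInstance, inferInstance, Fin k, inferInstance,
    relabelledFunctionals d ι, uniformGenerator _, Fintype.card_fin k,
    ldim_relabelledFunctionals ι.injective, uniformGenerator_isSymmetric _,
    uniformGenerator_isExact _, fun L => ?_⟩
  obtain ⟨c, hc⟩ := exists_le_expectedQueries_of_linear hd ι.injective
    (fun h hh => mem_relabelledFunctionals.1 hh) (le_card_relabelledFunctionals ι.injective) L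
  refine ⟨c, le_trans (ENNReal.ofReal_le_ofReal ?_) hc⟩
  have hpr : (2 : ℝ) ≤ p := by exact_mod_cast hp.two_le
  have hkp : (k : ℝ) ≤ 2 * p := by exact_mod_cast (by omega : k ≤ 2 * p)
  have hk0 : (0 : ℝ) < k := by exact_mod_cast (by omega : 0 < k)
  have hlogk : Real.log k ≤ 2 * Real.log p := by
    calc Real.log k ≤ Real.log (p * p) := Real.log_le_log hk0 (by nlinarith)
      _ = 2 * Real.log p := by rw [Real.log_mul (by positivity) (by positivity)]; ring
  have hlogp : 0 ≤ Real.log p := Real.log_nonneg (by linarith)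
  have hd0 : (0 : ℝ) ≤ d := Nat.cast_nonneg d
  calc 1 / 64 * (d : ℝ) * k * Real.log k ≤ 1 / 64 * d * k * (2 * Real.log p) :=
        mul_le_mul_of_nonneg_left hlogk (by positivity)
    _ = d * (k / 4) / 8 * Real.log p := by ring
    _ ≤ d * (p - 1) / 8 * Real.log p := by
        gcongr
        linarith

end BanditEQ

theorem theorem2 :
    (∃ C : ℝ, 0 < C ∧
      ∀ (X : Type u) (Y : Type v) [MeasurableSpace X] [Fintype Y] (H : Finset (X → Y)) (d : ℕ),
        (∀ h ∈ H, ∀ y : Y, MeasurableSet {x : X | h x = y}) →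
        1 ≤ d → ldim H = d →
        ∀ A : Generator H, A.IsSymmetric →
          ∃ L : Learner H, ∀ c : Hyp H,
            expectedQueries A L c ≤
              ENNReal.ofReal (C * d * Fintype.card Y * Real.log (Fintype.card Y))) ∧
    (∃ C : ℝ, 0 < C ∧
      (∀ (p d : ℕ) [Fact p.Prime], 3 ≤ p → 2 ≤ d →
        ldim (linearFunctionals p d) = d ∧
        (uniformGenerator (linearFunctionals p d)).IsSymmetric ∧
        (uniformGenerator (linearFunctionals p d)).IsExact ∧
        ∀ L : Learner (linearFunctionals p d), ∃ c : Hyp (linearFunctionals p d),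
          ENNReal.ofReal (C * d * p * Real.log p) ≤
            expectedQueries (uniformGenerator (linearFunctionals p d)) L c) ∧
      (∀ k d : ℕ, 2 ≤ k → 2 ≤ d →
        ∃ (X : Type) (_ : MeasurableSpace X) (_ : DiscreteMeasurableSpace X)
          (Y : Type) (_ : Fintype Y) (H : Finset (X → Y)) (A : Generator H),
          Fintype.card Y = k ∧
          ldim H = d ∧ A.IsSymmetric ∧ A.IsExact ∧
          ∀ L : Learner H, ∃ c : Hyp H,
            ENNReal.ofReal (C * d * k * Real.log k) ≤ expectedQueries A L c)) := by
  refine ⟨⟨96, by norm_num, fun X Y _ _ H d hH hd hdim A hA =>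
    exists_learner_expectedQueries_le hH hd hdim hA⟩, 1 / 64, by norm_num,
    fun p d _ hp hd => ⟨ldim_linearFunctionals hp (by omega), uniformGenerator_isSymmetric _,
      uniformGenerator_isExact _, exists_le_expectedQueries_linearFunctionals hd⟩,
    fun k d hk hd => exists_class_le_expectedQueries hk hd⟩
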